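/- **Problem.** An instance consists of a finite directed acyclic graph $G=(V,E)$ with $n=|V|$ unit-length jobs, a number $M\ge 1$ of identical machines and an integer communication delay $\rho$. A schedule is a finite set of triples (machine $m$, job $v$, time slot $t\in\{1,2,\dots\}$); jobs may be duplicated. It is feasible if every job is processed at least once, every machine processes at most one job per slot, and whenever $v$ is processed on $m$ in slot $t$ and $(u,v)\in E$, then $u$ is processed on $m$ in a slot $<t$ or on another machine in a slot $<t-\rho$. Its length is the largest slot used; $\mathsf{OPT}$ is the minimum length of a feasible schedule. For an induced subgraph $H$, $A_H(v)$ is the set of ancestors of $v$ in $H$ including $v$ (empty if $v\notin H$), $E_H(v)$ is the set of edges induced by $A_H(v)$, $A_H(B)=\bigcup_{v\in B}A_H(v)$, and $E_H(B)$ is the set of edges induced by $A_H(B)$. **Size estimates.** Let $\varepsilon=1/3$, $t=\lceil c/\varepsilon^2\rceil$, where $c,c'$ are constants. To estimate all $|A_H(v)|$, draw $\max(1,\lceil c'\ln n\rceil)$ independent uniform hash functions from a pairwise independent (strongly 2-universal) family $V\to\{1,\dots,N\}$, $N=n^3$. For each hash function keep for each $v$ the $t$ smallest hash values of $A_H(v)$,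 computed in topological order by inserting $v$ and merging the sketches of its predecessors. A sketch gives the value $tN/\ell$, $\ell$ being its largest entry, if it holds $t$ entries, and otherwise its number of entries. The estimate is the median over the hash functions. The sizes $|E_H(v)|$ are estimated in the same way, with hash functions $V\times V\to\{1,\dots,N\}$, $N=(n^2)^3$. Each invocation draws fresh hash functions. **Algorithm ScheduleGeneralGraph$(G)$**, with parameter $\gamma$. 1. While $G$ is non-empty: estimate the numbers of ancestors in the current $G$, and build $V_H$ with a queue initialised with the sources of $G$: remove the first $v$ from the queue, and if its estimate is at most $\frac43\rho$, mark it, add it to $V_H$ and enqueue each successor all of whose predecessors in $G$ are marked. When the queue is empty, record the induced subgraph $H$ on $V_H$ and remove $V_H$ from $G$. 2. For each recorded $H$ in order, while $H\ne\emptyset$: let $B=\mathrm{FindBatch}(H,\gamma)$; list-schedule the sets $A_H(v)$, $v\in B$ (each set, in topological order, is put as one contiguous block on a currently least loaded machine); then insert a delay of $\rho$ on all machines after the latest end time; remove $A_H(B)$ from $H$. FindBatch$(H,\gamma)$: start with $B=\emptyset$; put each $v$ in bucket $K_i$ if its edge estimate lies in $[2^i,2^{i+1})$, and in $K_0$ if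 it is smaller than $2$. While some bucket is non-empty: for each $i$ in decreasing order, sample vertices of $K_i$ uniformly without replacement until $K_i$ is empty or $\max(1,\lceil a\ln n\rceil)$ consecutive samples were stale ($a>0$ a constant); a sampled $v$ is fresh, and is appended to $B$, if $|A_H(v)\setminus A_H(B)|>\gamma|A_H(v)|$ and (unless $E_H(v)=\emptyset$) $|E_H(v)\setminus E_H(B)|>\gamma|E_H(v)|$, and is stale otherwise. Then, with $H'=H\setminus A_H(B)$, estimate all sizes in $H$ and in $H'$ and delete from its bucket every $v$ for which the ratio (estimate in $H'$)/(estimate in $H$) is at most $2\gamma$ for the number of ancestors, or for the number of edges if the edge estimate in $H$ is non-zero. Return $B$. **Theorem.** There are absolute constants $c_0$, $C$, $\rho_0$ such that for every $c\ge c_0$ and every $d\ge 1$ there is $c'_0$ such that for all $c'\ge c'_0$ and all $a>0$ the following holds for all $G$, $M\ge 1$, all integers $\rho\ge\rho_0$ and all hash families as above. With probability at least $1-n^{-d}$, algorithm ScheduleGeneralGraph with $\gamma=1/\sqrt{\ln\rho}$ halts and outputs a feasible schedule of length at most $$C\cdot\frac{\ln\rho}{\ln\ln\rho}\cdot(\mathsf{OPT}+\rho).$$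 -/

import Mathlib

noncomputable section

namespace CommDelay

open Finset
open scoped ENNReal

/-! ## Instances, schedules, optimum -/

section Scheduling

variable {V : Type*}

/-- A precedence graph is acyclic: no directed cycle of positive length (in particular no loop). -/
def Acyclic (G : Digraph V) : Prop :=
  ∀ v, ¬ Relation.TransGen G.Adj v v

/-- A schedule on `M` machines: a finite set of triples `(m, v, t)`, meaning that a copy of job `v`
is processed on machine `m` in the unit time slot `t`. Jobs may be duplicated. -/
abbrev Schedule (V : Type*) (M : ℕ) : Type _ := Finset (Fin M × V × ℕ)

/-- Feasibility with communication delay `ρ`; the time slots are `1, 2, 3, …`. -/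
structure IsFeasible (G : Digraph V) {M : ℕ} (ρ : ℕ) (σ : Schedule V M) : Prop where
  time_pos : ∀ m v t, (m, v, t) ∈ σ → 1 ≤ t
  all_jobs : ∀ v, ∃ m t, (m, v, t) ∈ σ
  one_at_a_time : ∀ m t u v, (m, u, t) ∈ σ → (m, v, t) ∈ σ → u = v
  precedence : ∀ m v t, (m, v, t) ∈ σ → ∀ u, G.Adj u v →
    (∃ t', (m, u, t') ∈ σ ∧ t' < t) ∨ (∃ m' t', m' ≠ m ∧ (m', u, t') ∈ σ ∧ t' + ρ < t)

/-- The makespan (length): the completion time of the last job. -/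
def makespan {M : ℕ} (σ : Schedule V M) : ℕ :=
  σ.sup fun p => p.2.2

/-- The length of an optimal schedule on `M` machines with communication delay `ρ`. -/
def OPT (G : Digraph V) (M ρ : ℕ) : ℕ :=
  sInf {T | ∃ σ : Schedule V M, IsFeasible G ρ σ ∧ makespan σ = T}

end Scheduling

/-! ## Induced subgraphs and ancestors

All subgraphs that occur are induced, and are represented by their vertex sets `S`. -/

section Ancestors

variable {V : Type*} [DecidableEq V]

open Classical in
/-- Immediate predecessors of `v` in the subgraph induced by `S`. -/
def pred (G : Digraph V) (S : Finset V) (v : V) : Finset V :=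
  S.filter fun u => G.Adj u v

open Classical in
/-- Immediate successors of `v` in the subgraph induced by `S`. -/
def succ (G : Digraph V) (S : Finset V) (v : V) : Finset V :=
  S.filter fun w => G.Adj v w

open Classical in
/-- Ancestors of `v`, including `v`, in the subgraph induced by `S` (none if `v ∉ S`). -/
def anc (G : Digraph V) (S : Finset V) (v : V) : Finset V :=
  S.filter fun u => v ∈ S ∧ Relation.ReflTransGen (fun a b => a ∈ S ∧ b ∈ S ∧ G.Adj a b) u v

/-- Ancestors of a set of vertices (listed in `B`). -/
def ancOf (G : Digraph V) (S : Finset V) (B : List V) : Finset V :=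
  B.toFinset.biUnion (anc G S)

open Classical in
/-- Edges of `G` induced by the vertex set `X`. -/
def edgesIn (G : Digraph V) (X : Finset V) : Finset (V × V) :=
  (X ×ˢ X).filter fun e => G.Adj e.1 e.2

/-- The vertices of `X ⊆ S` in a topological order of the subgraph induced by `S`: sorted by number
of ancestors (in an acyclic graph a proper ancestor of `v` has strictly fewer ancestors than `v`). -/
def topoSort (G : Digraph V) (S X : Finset V) : List V :=
  X.toList.mergeSort fun a b => decide (#(anc G S a) ≤ #(anc G S b))

end Ancestors

/-! ## Count-distinct estimator -/

/-- A (strongly) 2-universal family of hash functions from `α` to `{1, …, N}`: for a uniformly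
random member `h` and `x ≠ y`, the pair `(h x, h y)` is uniform on `{1, …, N}²`. -/
structure TwoUniversalFamily (α : Type*) (N : ℕ) where
  carrier : Finset (α → ℕ)
  nonempty : carrier.Nonempty
  mem_range : ∀ h ∈ carrier, ∀ x, h x ∈ Finset.Icc 1 N
  pairwise : ∀ x y, x ≠ y → ∀ i ∈ Finset.Icc 1 N, ∀ j ∈ Finset.Icc 1 N,
    #(carrier.filter fun h => h x = i ∧ h y = j) * N ^ 2 = #carrier

/-- `k` independent uniformly random members of a hash family. -/
def drawHashes {α : Type*} {N : ℕ} (F : TwoUniversalFamily α N) (k : ℕ) : PMF (Fin k → α → ℕ) :=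
  PMF.uniformOfFinset (Fintype.piFinset fun _ : Fin k => F.carrier)
    (Fintype.piFinset_nonempty.2 fun _ => F.nonempty)

/-- The `t` smallest elements of a finite set of numbers. -/
def smallest (t : ℕ) (T : Finset ℕ) : Finset ℕ :=
  T.filter fun x => #(T.filter fun y => y < x) < t

/-- Insert a hash value into a tree that keeps the `t` smallest values. -/
def insertTree (t x : ℕ) (T : Finset ℕ) : Finset ℕ :=
  smallest t (insert x T)

/-- Merge two such trees. -/
def mergeTree (t : ℕ) (T₁ T₂ : Finset ℕ) : Finset ℕ :=
  smallest t (T₁ ∪ T₂)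

/-- The estimate of one tree: `t N / ℓ` with `ℓ` the largest element kept, if the tree is full;
the number of stored values if fewer than `t` values were ever seen. -/
def treeEstimate (t N : ℕ) (T : Finset ℕ) : ℝ :=
  if #T < t then (#T : ℝ) else (t : ℝ) * N / (T.sup id : ℕ)

/-- The median: the entry with index `⌊k/2⌋` (counting from `0`) of the sorted list. -/
def median {k : ℕ} (x : Fin k → ℝ) : ℝ :=
  ((List.ofFn x).mergeSort fun a b => decide (a ≤ b)).getD (k / 2) 0

/-- The accuracy parameter of all estimation procedures. -/
def eps : ℝ := 1 / 3

/-- The size `c / ε²` of the trees. -/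
def treeSize (c : ℝ) : ℕ := ⌈c / eps ^ 2⌉₊

/-- A count `Θ(log n)` with constant `c`. -/
def logCount (c : ℝ) (n : ℕ) : ℕ := max 1 ⌈c * Real.log n⌉₊

/-- What the algorithm fixes besides its input: the constant `c` of the tree size, the constant `c'`
of the number of hash functions, the constant `a` of the number of consecutive stale samples,
and hash families for vertices and for edges, with range the cube of the size of their domain. -/
structure Config (V : Type*) [Fintype V] where
  c : ℝ
  c' : ℝ
  a : ℝ
  hashV : TwoUniversalFamily V (Fintype.card V ^ 3)
  hashE : TwoUniversalFamily (V × V) (Fintype.card (V × V) ^ 3)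

section Estimation

variable {V : Type*} [Fintype V] [DecidableEq V]

/-- For one hash function, the trees of the ancestor sets of all vertices of the subgraph induced
by `S`, computed by merging along a topological order. Vertices outside `S` have an empty tree. -/
def vertexTrees (G : Digraph V) (t : ℕ) (h : V → ℕ) (S : Finset V) : V → Finset ℕ :=
  (topoSort G S S).foldl
    (fun D w => Function.update D w
      ((pred G S w).toList.foldl (fun T v => mergeTree t T (D v)) (insertTree t (h w) ∅)))
    (fun _ => ∅)

/-- For one hash function, the trees of the sets of edges induced by the ancestors of each vertex. -/
def edgeTrees (G : Digraph V) (t : ℕ) (h : V × V → ℕ) (S : Finset V) : V → Finset ℕ :=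
  (topoSort G S S).foldl
    (fun D w => Function.update D w
      ((pred G S w).toList.foldl (fun T v => mergeTree t (insertTree t (h (v, w)) T) (D v)) ∅))
    (fun _ => ∅)

/-- Randomized estimates of the numbers of ancestors of all vertices in the subgraph induced by
`S`; every call draws fresh hash functions. -/
def estimateV (cfg : Config V) (G : Digraph V) (S : Finset V) : PMF (V → ℝ) :=
  (drawHashes cfg.hashV (logCount cfg.c' (Fintype.card V))).map fun h v =>
    median fun i => treeEstimate (treeSize cfg.c) (Fintype.card V ^ 3)
      (vertexTrees G (treeSize cfg.c) (h i) S v)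

/-- Randomized estimates of the numbers of edges induced by the ancestors of all vertices in the
subgraph induced by `S`. -/
def estimateE (cfg : Config V) (G : Digraph V) (S : Finset V) : PMF (V → ℝ) :=
  (drawHashes cfg.hashE (logCount cfg.c' (Fintype.card V))).map fun h v =>
    median fun i => treeEstimate (treeSize cfg.c) (Fintype.card (V × V) ^ 3)
      (edgeTrees G (treeSize cfg.c) (h i) S v)

end Estimation

/-! ## Randomized programs with while loops -/

/-- Randomized computations; the outcome `none` says that some loop ran out of fuel. -/
abbrev Rand (α : Type*) : Type _ := OptionT PMF α

/-- `while cond do body`, cut off after `fuel` iterations. -/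
def whileLoop {σ : Type*} (cond : σ → Prop) (body : σ → Rand σ) : ℕ → σ → Rand σ
  | 0, s => open Classical in if cond s then OptionT.fail else pure s
  | fuel + 1, s => open Classical in
      if cond s then (body s >>= fun s' => whileLoop cond body fuel s') else pure s

/-- The probability that a program (with loops cut off after `fuel` iterations, for each `fuel`)
halts with an output in `A`: the limit, i.e. the supremum, over the cut-off. -/
def outputProb {α : Type*} (prog : ℕ → Rand α) (A : Set α) : ℝ≥0∞ :=
  ⨆ fuel, (prog fuel).run.toOuterMeasure (some '' A)

/-! ## List scheduling -/

section ListScheduling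

variable {V : Type*} [DecidableEq V]

/-- A machine of smallest load. -/
def leastLoaded {M : ℕ} [NeZero M] (load : Fin M → ℕ) : Fin M :=
  Classical.choose (Finite.exists_min load)

/-- Put the jobs of `block`, in this order, on machine `m` in the slots `s + 1, s + 2, …`. -/
def placeBlock {M : ℕ} (m : Fin M) (s : ℕ) (block : List V) : Schedule V M :=
  (block.zipIdx.map fun p => (m, p.1, s + p.2 + 1)).toFinset

/-- Greedy list scheduling of blocks after time `start`: each block in turn goes to a machine of
smallest load. Returns the schedule and the largest load. -/
def listSchedule (M : ℕ) [NeZero M] (start : ℕ) (blocks : List (List V)) : Schedule V M × ℕ :=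
  let r := blocks.foldl
    (fun (st : Schedule V M × (Fin M → ℕ)) block =>
      let m := leastLoaded st.2
      (st.1 ∪ placeBlock m (start + st.2 m) block,
        Function.update st.2 m (st.2 m + block.length)))
    (∅, fun _ => 0)
  (r.1, univ.sup r.2)

end ListScheduling

/-! ## The algorithm -/

section Algorithm

variable {V : Type*} [Fintype V] [DecidableEq V]

/-- `v` is fresh with respect to the batch `B`: more than a `γ`-fraction of its ancestors and, if
there are any, of the edges induced by its ancestors are not already covered by `B`. -/
def Fresh (G : Digraph V) (H : Finset V) (γ : ℝ) (B : List V) (v : V) : Prop :=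
  γ * #(anc G H v) < #(anc G H v \ ancOf G H B) ∧
    ((edgesIn G (anc G H v)).Nonempty →
      γ * #(edgesIn G (anc G H v)) <
        #(edgesIn G (anc G H v) \ edgesIn G (ancOf G H B)))

/-- The index `i` with `2 ^ i ≤ x < 2 ^ (i + 1)`; all `x < 2` belong to the smallest bucket `0`. -/
def bucketIndex (x : ℝ) : ℕ := Nat.log 2 ⌊x⌋₊

/-- Sample from one bucket `K`, uniformly without replacement, until `N` consecutive samples were
stale or the bucket is empty. State: number of consecutive stale samples, bucket, batch. -/
def sampleBucket (G : Digraph V) (H : Finset V) (γ : ℝ) (N : ℕ) (fuel : ℕ)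
    (K : Finset V) (B : List V) : Rand (ℕ × Finset V × List V) :=
  whileLoop (fun st => st.1 < N ∧ st.2.1.Nonempty)
    (fun st => open Classical in
      if hK : st.2.1.Nonempty then do
        let v ← OptionT.lift (PMF.uniformOfFinset st.2.1 hK)
        if Fresh G H γ st.2.2 v then
          pure (0, st.2.1.erase v, st.2.2 ++ [v])
        else
          pure (st.1 + 1, st.2.1.erase v, st.2.2)
      else pure st)
    fuel (0, K, B)

/-- Remove from the buckets all vertices that look stale with respect to `B`. -/
def prune (cfg : Config V) (G : Digraph V) (H : Finset V) (γ : ℝ) (B : List V)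
    (K : ℕ → Finset V) : Rand (ℕ → Finset V) := do
  let H' := H \ ancOf G H B
  let nV ← OptionT.lift (estimateV cfg G H)
  let nE ← OptionT.lift (estimateE cfg G H)
  let nV' ← OptionT.lift (estimateV cfg G H')
  let nE' ← OptionT.lift (estimateE cfg G H')
  pure fun i => open Classical in (K i).filter fun v =>
    ¬ (nV' v / nV v ≤ 2 * γ ∨ (nE v ≠ 0 ∧ nE' v / nE v ≤ 2 * γ))

/-- Find a batch in the subgraph induced by `H`. State of the loop: buckets and batch. -/
def findBatch (cfg : Config V) (G : Digraph V) (γ : ℝ) (fuel : ℕ) (H : Finset V) :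
    Rand (List V) := do
  let N := logCount cfg.a (Fintype.card V)
  let nE ← OptionT.lift (estimateE cfg G H)
  let top := H.sup fun v => bucketIndex (nE v)
  let r ← whileLoop (fun st : (ℕ → Finset V) × List V => ∃ i, (st.1 i).Nonempty)
    (fun st => do
      let st' ← (List.range (top + 1)).reverse.foldlM
        (fun (st : (ℕ → Finset V) × List V) i => do
          let r ← sampleBucket G H γ N fuel (st.1 i) st.2
          pure (Function.update st.1 i r.2.1, r.2.2))
        st
      let K ← prune cfg G H γ st'.2 st'.1
      pure (K, st'.2))
    fuel ((fun i => H.filter fun v => bucketIndex (nE v) = i), [])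
  pure r.2

/-- Schedule the small subgraph induced by `H`, starting after the time stored in the clock.
State: remaining vertices, schedule so far, clock. -/
def scheduleSmallSubgraph (cfg : Config V) (G : Digraph V) (M : ℕ) [NeZero M] (ρ : ℕ) (γ : ℝ)
    (fuel : ℕ) (H : Finset V) (σ : Schedule V M) (clock : ℕ) : Rand (Schedule V M × ℕ) := do
  let r ← whileLoop (fun st : Finset V × Schedule V M × ℕ => st.1.Nonempty)
    (fun st => do
      let B ← findBatch cfg G γ fuel st.1
      let L := listSchedule M st.2.2 (B.map fun v => topoSort G st.1 (anc G st.1 v))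
      pure (st.1 \ ancOf G st.1 B, st.2.1 ∪ L.1, st.2.2 + L.2 + ρ))
    fuel (H, σ, clock)
  pure r.2

/-- Build one small subgraph of the graph induced by `R`, given estimates `nV` of the numbers of
ancestors. State: queue, marked vertices (the vertices of the subgraph). -/
def buildSmall (G : Digraph V) (ρ : ℕ) (nV : V → ℝ) (fuel : ℕ) (R : Finset V) :
    Rand (List V × Finset V) :=
  whileLoop (fun st => st.1 ≠ [])
    (fun st => match st.1 with
      | [] => pure st
      | v :: Q =>
        if nV v ≤ 4 / 3 * (ρ : ℝ) then
          let X := insert v st.2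
          pure (Q ++ ((succ G R v).filter fun w => pred G R w ⊆ X).toList, X)
        else pure (Q, st.2))
    fuel ((R.filter fun v => pred G R v = ∅).toList, ∅)

/-- The list of small subgraphs. State: remaining vertices, small subgraphs in order. -/
def partitionGraph (cfg : Config V) (G : Digraph V) (ρ : ℕ) (fuel : ℕ) :
    Rand (List (Finset V)) := do
  let r ← whileLoop (fun st : Finset V × List (Finset V) => st.1.Nonempty)
    (fun st => do
      let nV ← OptionT.lift (estimateV cfg G st.1)
      let q ← buildSmall G ρ nV fuel st.1
      pure (st.1 \ q.2, st.2 ++ [q.2]))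
    fuel (univ, [])
  pure r.2

/-- The main algorithm, with `γ` as a parameter. -/
def scheduleGeneralGraph (cfg : Config V) (G : Digraph V) (M : ℕ) [NeZero M] (ρ : ℕ) (γ : ℝ)
    (fuel : ℕ) : Rand (Schedule V M) := do
  let Hs ← partitionGraph cfg G ρ fuel
  let r ← Hs.foldlM
    (fun (st : Schedule V M × ℕ) H => scheduleSmallSubgraph cfg G M ρ γ fuel H st.1 st.2)
    (∅, 0)
  pure r.1

end Algorithm

end CommDelay

end

/-!
All estimates of a run are accurate with high probability: the `t`-th smallest of the pairwise
independent hash values is concentrated by Chebyshev's inequality, and the median over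
`Θ(log n)` hash functions makes the error small enough for a union bound over all jobs and all
calls. Given accurate estimates, the length of the schedule is bounded as follows.

* Every layer consists of jobs with at most `2ρ` ancestors. A job that is left for a later layer
  depends on a job with more than `ρ` ancestors in the current graph. These either occupy one
  machine for more than `ρ` slots or have to be communicated, so the job starts at least `ρ` slots
  later than the current graph. So `k` layers force `OPT ≥ (k - 1) ρ`.
* A batch consists of fresh jobs, so the sizes of its ancestor sets add up to at most `1 / γ` times
  the number of jobs that it removes. Summed over all batches, list scheduling therefore spends at
  most `n / (γ M) ≤ OPT / γ` slots on its loads, and an excess of `3ρ` per batch.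
* Every job that is not removed by a batch loses all but a fraction `4γ` of its ancestors or of
  their edges. The product of the two numbers is at most `8ρ³` at first, hence there are
  `O(log ρ / log (1 / γ)) = O(log ρ / log log ρ)` batches per layer.
-/

namespace CommDelay

open Finset
open scoped ENNReal

universe u

section FailureProbability

variable {α β : Type u} {δ δ' : ℝ≥0∞}

/-- A Hoare-style postcondition: except with probability at most `δ`, the program halts with an
output satisfying `Q`. Running out of fuel counts as failure. -/
def HoldsExcept (x : Rand α) (δ : ℝ≥0∞) (Q : α → Prop) : Prop :=
  x.run.toOuterMeasure (some '' {a | Q a})ᶜ ≤ δ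

theorem toOuterMeasure_univ (p : PMF α) : p.toOuterMeasure Set.univ = 1 :=
  (p.toOuterMeasure_apply_eq_one_iff _).2 (Set.subset_univ _)

theorem toOuterMeasure_le_one (p : PMF α) (s : Set α) : p.toOuterMeasure s ≤ 1 :=
  (p.toOuterMeasure.mono (Set.subset_univ s)).trans_eq (toOuterMeasure_univ p)

namespace HoldsExcept

variable {x : Rand α} {f : α → Rand β} {Q Q' : α → Prop} {R : β → Prop}

theorem mono_prob (h : HoldsExcept x δ Q) (hδ : δ ≤ δ') : HoldsExcept x δ' Q :=
  h.trans hδ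

theorem mono (h : HoldsExcept x δ Q) (hQ : ∀ a, Q a → Q' a) : HoldsExcept x δ Q' :=
  (MeasureTheory.measure_mono (Set.compl_subset_compl.2 (Set.image_mono hQ))).trans h

theorem pure {a : α} (h : Q a) : HoldsExcept (Pure.pure a : Rand α) δ Q := by
  have hrun : (Pure.pure a : Rand α).run = PMF.pure (some a) := rfl
  rw [HoldsExcept, hrun, PMF.toOuterMeasure_pure_apply, if_neg (by simpa using h)]
  exact zero_le

theorem lift {p : PMF α} (h : p.toOuterMeasure {a | ¬ Q a} ≤ δ) :
    HoldsExcept (OptionT.lift p : Rand α) δ Q := by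
  have hrun : (OptionT.lift p : Rand α).run = p.map some := rfl
  rw [HoldsExcept, hrun, PMF.toOuterMeasure_map_apply, Set.preimage_compl,
    Set.preimage_image_eq _ (Option.some_injective α)]
  exact h

theorem lift_uniformOfFinset {K : Finset α} (hK : K.Nonempty) :
    HoldsExcept (OptionT.lift (PMF.uniformOfFinset K hK)) 0 (· ∈ K) := by
  refine HoldsExcept.lift ((PMF.toOuterMeasure_apply_eq_zero_iff _ _).2 ?_).le
  simp [Set.disjoint_left]

theorem bind (hx : HoldsExcept x δ Q) (hf : ∀ a, Q a → HoldsExcept (f a) δ' R) :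
    HoldsExcept (x >>= f) (δ + δ') R := by
  have hrun : (x >>= f).run = x.run.bind fun o => o.elim (PMF.pure none) fun a => (f a).run := by
    rw [OptionT.run_bind]
    refine congrArg x.run.bind (funext fun o => ?_)
    cases o <;> rfl
  unfold HoldsExcept at *
  rw [hrun, PMF.toOuterMeasure_bind_apply]
  calc _ ≤ ∑' o, ((some '' {a | Q a})ᶜ.indicator x.run o + x.run o * δ') := by
        refine ENNReal.tsum_le_tsum fun o => ?_
        by_cases ho : o ∈ some '' {a | Q a}
        · obtain ⟨a, ha, rfl⟩ := ho
          exact le_add_left (mul_le_mul_right (hf a ha) _)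
        · rw [Set.indicator_of_mem (Set.mem_compl ho)]
          exact le_add_right (mul_le_of_le_one_right' (toOuterMeasure_le_one _ _))
    _ ≤ δ + δ' := by
        rw [ENNReal.tsum_add, ENNReal.tsum_mul_right, PMF.tsum_coe, one_mul,
          ← PMF.toOuterMeasure_apply]
        gcongr

theorem bind_of_zero (hx : HoldsExcept x 0 Q) (hf : ∀ a, Q a → HoldsExcept (f a) δ R) :
    HoldsExcept (x >>= f) δ R :=
  (hx.bind hf).mono_prob (zero_add δ).le

theorem bind_pure {g : α → β} (hx : HoldsExcept x δ Q) (hg : ∀ a, Q a → R (g a)) :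
    HoldsExcept (x >>= fun a => Pure.pure (g a)) δ R :=
  (hx.bind fun a ha => HoldsExcept.pure (δ := 0) (hg a ha)).mono_prob (add_zero δ).le

theorem ite {c : Prop} [Decidable c] {y : Rand α} (hx : c → HoldsExcept x δ Q)
    (hy : ¬ c → HoldsExcept y δ Q) : HoldsExcept (if c then x else y) δ Q := by
  split_ifs with h
  exacts [hx h, hy h]

/-- The failure probability of the body is paid once for every unit of the variant `m`. -/
theorem whileLoop {cond : α → Prop} {body : α → Rand α} (Inv : α → Prop) (m : α → ℕ)
    (hbody : ∀ s, Inv s → cond s → HoldsExcept (body s) δ fun s' => Inv s' ∧ m s' < m s)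
    (hpos : ∀ s, Inv s → cond s → 0 < m s) :
    ∀ {fuel : ℕ} {s : α}, Inv s → m s ≤ fuel →
      HoldsExcept (whileLoop cond body fuel s) (m s * δ) fun s' => Inv s' ∧ ¬ cond s' := by
  intro fuel
  induction fuel with
  | zero =>
    intro s hs hm
    have hc : ¬ cond s := fun hc => (hpos s hs hc).not_ge hm
    rw [CommDelay.whileLoop, if_neg hc]
    exact HoldsExcept.pure ⟨hs, hc⟩
  | succ fuel ih =>
    intro s hs hm
    classical
    rw [CommDelay.whileLoop]
    refine HoldsExcept.ite (fun hc => ?_) fun hc => HoldsExcept.pure ⟨hs, hc⟩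
    obtain ⟨k, hk⟩ := Nat.exists_eq_succ_of_ne_zero (hpos s hs hc).ne'
    have hrest : ∀ s', Inv s' ∧ m s' < m s → HoldsExcept
        (CommDelay.whileLoop cond body fuel s') (k * δ) fun s' => Inv s' ∧ ¬ cond s' := by
      intro s' hs'
      refine (ih hs'.1 (by omega)).mono_prob ?_
      gcongr
      omega
    refine ((hbody s hs hc).bind hrest).mono_prob (le_of_eq ?_)
    rw [hk, Nat.succ_eq_add_one, Nat.cast_add_one, add_mul, one_mul, add_comm]

/-- The invariant of a loop over a list may depend on the part of the list already processed. -/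
theorem foldlM {ι : Type*} {body : α → ι → Rand α} (Inv : List ι → α → Prop) :
    ∀ {l : List ι} {s : α}, Inv [] s →
      (∀ l₁ i l₂ s, l = l₁ ++ i :: l₂ → Inv l₁ s → HoldsExcept (body s i) δ (Inv (l₁ ++ [i]))) →
      HoldsExcept (l.foldlM body s) (l.length * δ) (Inv l) := by
  intro l
  induction l generalizing Inv with
  | nil => exact fun hs _ => HoldsExcept.pure hs
  | cons i l ih =>
    intro s hs hbody
    rw [List.foldlM_cons]
    refine ((hbody [] i l s rfl hs).bind fun s' hs' => ih (fun l₁ => Inv (i :: l₁)) hs'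
      fun l₁ j l₂ s'' hl h => hbody (i :: l₁) j l₂ s'' (by rw [hl, List.cons_append]) h).mono_prob
        (le_of_eq ?_)
    rw [List.length_cons, Nat.cast_add_one, add_mul, one_mul, add_comm]

theorem le_outputProb {prog : ℕ → Rand α} {A : Set α} {fuel : ℕ}
    (h : HoldsExcept (prog fuel) δ (· ∈ A)) : 1 - δ ≤ outputProb prog A := by
  have hsplit : 1 ≤ (prog fuel).run.toOuterMeasure (some '' A) +
      (prog fuel).run.toOuterMeasure (some '' A)ᶜ := by
    rw [← toOuterMeasure_univ (prog fuel).run, ← Set.union_compl_self (some '' A)]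
    exact MeasureTheory.measure_union_le _ _
  refine le_trans ?_ (le_iSup (fun fuel => (prog fuel).run.toOuterMeasure (some '' A)) fuel)
  exact tsub_le_iff_right.2 (hsplit.trans (add_le_add_right h _))

end HoldsExcept

end FailureProbability

section Ancestors

variable {V : Type*} {G : Digraph V} {S S' X Y : Finset V} {u v w : V}

theorem mem_pred : u ∈ pred G S v ↔ u ∈ S ∧ G.Adj u v := by
  simp [pred]

theorem mem_succ : w ∈ succ G S v ↔ w ∈ S ∧ G.Adj v w := by
  simp [succ]

theorem Acyclic.not_adj_self (hG : Acyclic G) : ¬ G.Adj v v :=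
  fun h => hG v (.single h)

theorem mem_edgesIn {e : V × V} : e ∈ edgesIn G X ↔ e.1 ∈ X ∧ e.2 ∈ X ∧ G.Adj e.1 e.2 := by
  simp [edgesIn, and_assoc]

theorem edgesIn_mono (h : X ⊆ Y) : edgesIn G X ⊆ edgesIn G Y := fun _ he =>
  let ⟨h₁, h₂, hadj⟩ := mem_edgesIn.1 he
  mem_edgesIn.2 ⟨h h₁, h h₂, hadj⟩

theorem card_edgesIn_le (X : Finset V) : #(edgesIn G X) ≤ #X ^ 2 := by
  rw [sq, ← card_product]
  exact card_le_card fun _ he => mem_product.2 ((mem_edgesIn.1 he).imp_right And.left)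

variable [DecidableEq V]

theorem mem_anc : u ∈ anc G S v ↔
    u ∈ S ∧ v ∈ S ∧ Relation.ReflTransGen (fun a b => a ∈ S ∧ b ∈ S ∧ G.Adj a b) u v := by
  simp [anc]

theorem anc_subset : anc G S v ⊆ S :=
  fun _ h => (mem_anc.1 h).1

theorem mem_of_mem_anc (h : u ∈ anc G S v) : v ∈ S :=
  (mem_anc.1 h).2.1

theorem self_mem_anc (h : v ∈ S) : v ∈ anc G S v :=
  mem_anc.2 ⟨h, h, .refl⟩

theorem card_anc_pos (h : v ∈ S) : 0 < #(anc G S v) :=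
  card_pos.2 ⟨v, self_mem_anc h⟩

theorem anc_of_notMem (h : v ∉ S) : anc G S v = ∅ :=
  eq_empty_of_forall_notMem fun _ hu => h (mem_of_mem_anc hu)

theorem anc_subset_anc (h : u ∈ anc G S v) : anc G S u ⊆ anc G S v := fun _ hw =>
  mem_anc.2 ⟨anc_subset hw, mem_of_mem_anc h, (mem_anc.1 hw).2.2.trans (mem_anc.1 h).2.2⟩

theorem pred_subset_anc (hv : v ∈ S) : pred G S v ⊆ anc G S v := fun _ hu =>
  let ⟨hu, hadj⟩ := mem_pred.1 hu
  mem_anc.2 ⟨hu, hv, .single ⟨hu, hv, hadj⟩⟩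

theorem anc_mono (h : S' ⊆ S) : anc G S' v ⊆ anc G S v := fun _ hu => by
  obtain ⟨hu, hv, hpath⟩ := mem_anc.1 hu
  exact mem_anc.2 ⟨h hu, h hv, hpath.lift id fun _ _ hab => ⟨h hab.1, h hab.2.1, hab.2.2⟩⟩

theorem anc_eq_insert_biUnion_pred (hv : v ∈ S) :
    anc G S v = insert v ((pred G S v).biUnion (anc G S)) := by
  ext u
  simp only [mem_insert, mem_biUnion]
  constructor
  · intro h
    obtain ⟨hu, -, hpath⟩ := mem_anc.1 h
    rcases hpath.cases_tail with h | ⟨w, huw, hw, -, hadj⟩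
    · exact .inl h.symm
    · exact .inr ⟨w, mem_pred.2 ⟨hw, hadj⟩, mem_anc.2 ⟨hu, hw, huw⟩⟩
  · rintro (rfl | ⟨w, hw, hu⟩)
    · exact self_mem_anc hv
    · exact anc_subset_anc (pred_subset_anc hv hw) hu

theorem Acyclic.eq_of_mem_anc (hG : Acyclic G) (huv : u ∈ anc G S v) (hvu : v ∈ anc G S u) :
    u = v := by
  have path : ∀ {a b}, a ∈ anc G S b → Relation.ReflTransGen G.Adj a b := fun h =>
    (mem_anc.1 h).2.2.lift id fun _ _ hab => hab.2.2
  rcases Relation.reflTransGen_iff_eq_or_transGen.1 (path huv) with h | h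
  · exact h.symm
  · exact absurd (h.trans_left (path hvu)) (hG u)

theorem Acyclic.card_anc_lt (hG : Acyclic G) (huv : u ∈ anc G S v) (hne : u ≠ v) :
    #(anc G S u) < #(anc G S v) :=
  card_lt_card ⟨anc_subset_anc huv, fun h =>
    hne (hG.eq_of_mem_anc huv (h (self_mem_anc (mem_of_mem_anc huv))))⟩

theorem Acyclic.card_anc_lt_of_mem_pred (hG : Acyclic G) (hv : v ∈ S) (h : u ∈ pred G S v) :
    #(anc G S u) < #(anc G S v) :=
  hG.card_anc_lt (pred_subset_anc hv h) fun huv => hG.not_adj_self (huv ▸ (mem_pred.1 h).2)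

theorem edgesIn_anc_eq_biUnion_pred (hw : w ∈ S) :
    edgesIn G (anc G S w) =
      (pred G S w).biUnion fun v => insert (v, w) (edgesIn G (anc G S v)) := by
  ext ⟨a, b⟩
  simp only [mem_edgesIn, mem_biUnion, mem_insert, Prod.mk.injEq]
  constructor
  · rintro ⟨ha, hb, hab⟩
    have hpred : a ∈ pred G S b := mem_pred.2 ⟨anc_subset ha, hab⟩
    have hbS : b ∈ S := anc_subset hb
    rw [anc_eq_insert_biUnion_pred hw, mem_insert, mem_biUnion] at hb
    rcases hb with rfl | ⟨v, hv, hb⟩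
    · exact ⟨a, hpred, .inl ⟨rfl, rfl⟩⟩
    · exact ⟨v, hv, .inr ⟨anc_subset_anc hb (pred_subset_anc hbS hpred), hb, hab⟩⟩
  · rintro ⟨v, hv, ⟨rfl, rfl⟩ | ⟨ha, hb, hab⟩⟩
    · exact ⟨pred_subset_anc hw hv, self_mem_anc hw, (mem_pred.1 hv).2⟩
    · have hsub := anc_subset_anc (pred_subset_anc hw hv)
      exact ⟨hsub ha, hsub hb, hab⟩

variable {B B' : List V}

theorem mem_ancOf : u ∈ ancOf G S B ↔ ∃ v ∈ B, u ∈ anc G S v := by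
  simp [ancOf]

theorem ancOf_subset : ancOf G S B ⊆ S := fun _ h =>
  let ⟨_, _, hv⟩ := mem_ancOf.1 h
  anc_subset hv

theorem ancOf_mono (h : B ⊆ B') : ancOf G S B ⊆ ancOf G S B' := fun _ hu =>
  let ⟨v, hv, huv⟩ := mem_ancOf.1 hu
  mem_ancOf.2 ⟨v, h hv, huv⟩

theorem ancOf_concat : ancOf G S (B ++ [v]) = ancOf G S B ∪ anc G S v := by
  ext u
  simp [mem_ancOf, or_and_right, exists_or]

theorem anc_sdiff_ancOf_subset : anc G (S \ ancOf G S B) v ⊆ anc G S v \ ancOf G S B :=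
  fun _ hu => mem_sdiff.2 ⟨anc_mono sdiff_subset hu, (mem_sdiff.1 (anc_subset hu)).2⟩

theorem edgesIn_anc_sdiff_ancOf_subset :
    edgesIn G (anc G (S \ ancOf G S B) v) ⊆ edgesIn G (anc G S v) \ edgesIn G (ancOf G S B) := by
  intro e he
  have hsource := (mem_sdiff.1 (anc_subset (mem_edgesIn.1 he).1)).2
  exact mem_sdiff.2
    ⟨edgesIn_mono (anc_mono sdiff_subset) he, fun h => hsource (mem_edgesIn.1 h).1⟩

theorem mem_topoSort : v ∈ topoSort G S X ↔ v ∈ X := by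
  simp [topoSort]

theorem length_topoSort : (topoSort G S X).length = #X := by
  simp [topoSort]

theorem pairwise_topoSort :
    (topoSort G S X).Pairwise fun a b => #(anc G S a) ≤ #(anc G S b) := by
  refine (List.pairwise_mergeSort (le := fun a b => decide (#(anc G S a) ≤ #(anc G S b)))
    ?_ ?_ X.toList).imp of_decide_eq_true
  · intro a b c hab hbc
    exact decide_eq_true ((of_decide_eq_true hab).trans (of_decide_eq_true hbc))
  · intro a b
    simpa using le_total #(anc G S a) #(anc G S b)

end Ancestors

section Sketches

variable {t x : ℕ} {X Y : Finset ℕ}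

theorem mem_smallest : x ∈ smallest t X ↔ x ∈ X ∧ #(X.filter (· < x)) < t := by
  simp [smallest]

theorem smallest_subset : smallest t X ⊆ X :=
  filter_subset _ _

theorem smallest_eq_self (h : #X < t) : smallest t X = X :=
  smallest_subset.antisymm fun _ hx => mem_smallest.2 ⟨hx, (card_filter_le _ _).trans_lt h⟩

theorem smallest_empty : smallest t ∅ = ∅ := rfl

theorem le_card_smallest (h : t ≤ #X) : t ≤ #(smallest t X) := by
  rcases eq_or_ne (X \ smallest t X) ∅ with hall | hne
  · exact h.trans (card_le_card (sdiff_eq_empty_iff_subset.1 hall))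
  obtain ⟨hx, hmin⟩ := (X \ smallest t X).isLeast_min' (nonempty_iff_ne_empty.2 hne)
  set x := (X \ smallest t X).min' (nonempty_iff_ne_empty.2 hne)
  obtain ⟨hxX, hx⟩ := mem_sdiff.1 hx
  calc t ≤ #(X.filter (· < x)) := not_lt.1 fun hlt => hx (mem_smallest.2 ⟨hxX, hlt⟩)
    _ ≤ #(smallest t X) := card_le_card fun y hy => by
      obtain ⟨hyX, hyx⟩ := mem_filter.1 hy
      by_contra hys
      exact hyx.not_ge (hmin (mem_sdiff.2 ⟨hyX, hys⟩))

theorem filter_lt_smallest : (smallest t X).filter (· < x) = smallest t (X.filter (· < x)) := by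
  ext y
  simp only [mem_filter, mem_smallest, filter_filter]
  have hfilter (hyx : y < x) : (X.filter fun z => z < x ∧ z < y) = X.filter (· < y) :=
    filter_congr fun z _ => ⟨And.right, fun hzy => ⟨hzy.trans hyx, hzy⟩⟩
  constructor
  · rintro ⟨⟨hyX, hcard⟩, hyx⟩
    exact ⟨⟨hyX, hyx⟩, (hfilter hyx).symm ▸ hcard⟩
  · rintro ⟨⟨hyX, hyx⟩, hcard⟩
    exact ⟨⟨hyX, hfilter hyx ▸ hcard⟩, hyx⟩

theorem smallest_smallest_union : smallest t (smallest t X ∪ Y) = smallest t (X ∪ Y) := by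
  have hcard : ∀ x, #((smallest t X ∪ Y).filter (· < x)) < t ↔ #((X ∪ Y).filter (· < x)) < t := by
    intro x
    rw [filter_union, filter_union, filter_lt_smallest]
    rcases lt_or_ge #(X.filter (· < x)) t with hlt | hge
    · rw [smallest_eq_self hlt]
    · exact iff_of_false
        ((le_card_smallest hge).trans (card_le_card subset_union_left)).not_gt
        (hge.trans (card_le_card subset_union_left)).not_gt
  ext x
  rw [mem_smallest, mem_smallest, hcard, mem_union, mem_union]
  refine and_congr_left fun hx => or_congr_left ⟨fun h => smallest_subset h, fun h => ?_⟩
  exact mem_smallest.2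
    ⟨h, (card_le_card (filter_subset_filter _ subset_union_left)).trans_lt hx⟩

theorem mergeTree_smallest : mergeTree t (smallest t X) (smallest t Y) = smallest t (X ∪ Y) := by
  rw [mergeTree, smallest_smallest_union, union_comm, smallest_smallest_union, union_comm]

theorem insertTree_smallest : insertTree t x (smallest t X) = smallest t (insert x X) := by
  rw [insertTree, insert_eq, union_comm, smallest_smallest_union, union_comm, ← insert_eq]

theorem foldl_smallest_eq_biUnion {ι : Type*} [DecidableEq ι] {f : Finset ℕ → ι → Finset ℕ}
    {A : ι → Finset ℕ} {l : List ι}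
    (hf : ∀ i ∈ l, ∀ Y, f (smallest t Y) i = smallest t (Y ∪ A i)) :
    l.foldl f (smallest t X) = smallest t (X ∪ l.toFinset.biUnion A) := by
  induction l generalizing X with
  | nil => simp
  | cons i l ih =>
    rw [List.foldl_cons, hf i List.mem_cons_self,
      ih fun j hj => hf j (List.mem_cons_of_mem i hj), List.toFinset_cons, biUnion_insert,
      union_assoc]

end Sketches

section DynamicProgramming

variable {V : Type*} [DecidableEq V] {G : Digraph V} {S X : Finset V}

theorem foldl_update_eq_of_pairwise {β : Type*} {value : V → β} {step : (V → β) → V → β}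
    {dep : V → V → Prop} {l : List V}
    (hstep : ∀ w ∈ l, ∀ D, (∀ u, dep u w → D u = value u) → step D w = value w)
    (hl : l.Pairwise fun a b => ¬ dep b a) (hirrefl : ∀ w ∈ l, ¬ dep w w)
    {D : V → β} (hD : ∀ v, v ∈ l ∨ D v = value v) :
    l.foldl (fun D w => Function.update D w (step D w)) D = value := by
  induction l generalizing D with
  | nil => exact funext fun v => (hD v).resolve_left List.not_mem_nil
  | cons w l ih =>
    obtain ⟨hw, hl⟩ := List.pairwise_cons.1 hl
    have hvalue : step D w = value w := by
      refine hstep w List.mem_cons_self D fun u hu => (hD u).resolve_left fun hul => ?_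
      rcases List.mem_cons.1 hul with rfl | hul
      · exact hirrefl u List.mem_cons_self hu
      · exact hw u hul hu
    rw [List.foldl_cons]
    refine ih (fun v hv => hstep v (List.mem_cons_of_mem w hv)) hl
      (fun v hv => hirrefl v (List.mem_cons_of_mem w hv)) fun v => ?_
    rcases eq_or_ne v w with rfl | hvw
    · exact .inr (by rw [Function.update_self, hvalue])
    · rw [Function.update_of_ne hvw]
      exact (hD v).imp_left fun hv => (List.mem_cons.1 hv).resolve_left hvw

theorem Acyclic.pairwise_topoSort_notMem_pred (hG : Acyclic G) (hX : X ⊆ S) :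
    (topoSort G S X).Pairwise fun a b => b ∉ pred G S a :=
  pairwise_topoSort.imp_of_mem fun ha _ hab hba =>
    (hG.card_anc_lt_of_mem_pred (hX (mem_topoSort.1 ha)) hba).not_ge hab

theorem Acyclic.foldl_topoSort_eq (hG : Acyclic G) {β : Type*} {value : V → β}
    {step : (V → β) → V → β} {D : V → β} (hD : ∀ v ∉ S, D v = value v)
    (hstep : ∀ w ∈ S, ∀ D, (∀ u ∈ pred G S w, D u = value u) → step D w = value w) :
    (topoSort G S S).foldl (fun D w => Function.update D w (step D w)) D = value :=
  foldl_update_eq_of_pairwise (dep := fun u w => u ∈ pred G S w)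
    (fun w hw => hstep w (mem_topoSort.1 hw))
    (hG.pairwise_topoSort_notMem_pred Subset.rfl)
    (fun _ _ h => hG.not_adj_self (mem_pred.1 h).2)
    fun v => (em (v ∈ S)).imp mem_topoSort.2 (hD v)

theorem vertexTrees_eq (hG : Acyclic G) (t : ℕ) (h : V → ℕ) :
    vertexTrees G t h S = fun v => smallest t ((anc G S v).image h) := by
  refine hG.foldl_topoSort_eq (fun v hv => by simp [anc_of_notMem hv, smallest_empty])
    fun w hw D hD => ?_
  rw [← smallest_empty (t := t), insertTree_smallest,
    foldl_smallest_eq_biUnion (A := fun v => (anc G S v).image h), toList_toFinset,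
    ← biUnion_image, anc_eq_insert_biUnion_pred hw, image_insert]
  · rfl
  · intro v hv Y
    rw [hD v (mem_toList.1 hv), mergeTree_smallest]

theorem edgeTrees_eq (hG : Acyclic G) (t : ℕ) (h : V × V → ℕ) :
    edgeTrees G t h S = fun v => smallest t ((edgesIn G (anc G S v)).image h) := by
  refine hG.foldl_topoSort_eq (fun v hv => ?_) fun w hw D hD => ?_
  · have : edgesIn G ∅ = ∅ := eq_empty_of_forall_notMem fun e he => by simp [mem_edgesIn] at he
    simp [anc_of_notMem hv, this, smallest_empty]
  rw [← smallest_empty (t := t),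
    foldl_smallest_eq_biUnion (A := fun v => (insert (v, w) (edgesIn G (anc G S v))).image h),
    toList_toFinset, ← biUnion_image, edgesIn_anc_eq_biUnion_pred hw, empty_union]
  intro v hv Y
  rw [hD v (mem_toList.1 hv), insertTree_smallest, mergeTree_smallest, image_insert,
    insert_union, union_insert]

end DynamicProgramming

/-- `x` estimates the cardinality `s` up to a factor `1 ± 1/3`, the precision `eps` at which all
estimation procedures are run. -/
def Accurate (x : ℝ) (s : ℕ) : Prop :=
  2 / 3 * (s : ℝ) ≤ x ∧ x ≤ 4 / 3 * (s : ℝ)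

/-- The number of elements of `A` with hash value at most `x`. The threshold is real because the
thresholds that decide the accuracy of a sketch are not integral. -/
noncomputable def hashCount {α : Type*} (h : α → ℕ) (A : Finset α) (x : ℝ) : ℕ :=
  #(A.filter fun a => (h a : ℝ) ≤ x)

/-- The estimate of `#A` obtained from one hash function `h`. -/
noncomputable def sketchEstimate {α : Type*} (t N : ℕ) (h : α → ℕ) (A : Finset α) : ℝ :=
  treeEstimate t N (smallest t (A.image h))

section SketchAccuracy

variable {α : Type*} {A : Finset α} {h : α → ℕ} {t N : ℕ} {x : ℝ}

theorem card_image_filter_eq_hashCount (hinj : Set.InjOn h A) :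
    #((A.image h).filter fun y : ℕ => (y : ℝ) ≤ x) = hashCount h A x := by
  rw [filter_image, card_image_of_injOn (hinj.mono (coe_subset.2 (filter_subset _ _))), hashCount]

theorem accurate_sketchEstimate_of_card_lt (hinj : Set.InjOn h A) (hA : #A < t) :
    Accurate (sketchEstimate t N h A) #A := by
  have hcard : #(A.image h) = #A := card_image_of_injOn hinj
  rw [sketchEstimate, smallest_eq_self (hcard.trans_lt hA), treeEstimate, hcard, if_pos hA]
  have : (0 : ℝ) ≤ #A := Nat.cast_nonneg _
  constructor <;> linarith

theorem sup_smallest_le_iff_le_hashCount (hinj : Set.InjOn h A) (ht : 0 < t) (hA : t ≤ #A) :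
    (((smallest t (A.image h)).sup id : ℕ) : ℝ) ≤ x ↔ t ≤ hashCount h A x := by
  have hfull : t ≤ #(smallest t (A.image h)) :=
    le_card_smallest (hA.trans_eq (card_image_of_injOn hinj).symm)
  rw [← card_image_filter_eq_hashCount hinj]
  constructor
  · intro hsup
    refine hfull.trans (card_le_card fun y hy => mem_filter.2 ⟨smallest_subset hy, ?_⟩)
    exact le_trans (by exact_mod_cast le_sup (f := id) hy) hsup
  · intro hcount
    obtain ⟨l, hl, hsup⟩ := exists_mem_eq_sup _ (card_pos.1 (ht.trans_le hfull)) id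
    rw [hsup]
    by_contra! hlx
    refine (hcount.trans (card_le_card fun y hy => ?_)).not_gt (mem_smallest.1 hl).2
    obtain ⟨hyA, hyx⟩ := mem_filter.1 hy
    exact mem_filter.2 ⟨hyA, by exact_mod_cast hyx.trans_lt hlx⟩

/-- The estimate `t N / ℓ` lies in `[2s/3, 4s/3]` when `3tN/(4s) ≤ ℓ ≤ 3tN/(2s)`. -/
theorem accurate_sketchEstimate_of_hashCount (hinj : Set.InjOn h A) (ht : 0 < t) (hA : t ≤ #A)
    (hN : 0 < N) (hlow : hashCount h A (3 * t * N / (4 * #A)) < t)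
    (hhigh : t ≤ hashCount h A (3 * t * N / (2 * #A))) :
    Accurate (sketchEstimate t N h A) #A := by
  have hfull : t ≤ #(smallest t (A.image h)) :=
    le_card_smallest (hA.trans_eq (card_image_of_injOn hinj).symm)
  have htR : (0 : ℝ) < t := Nat.cast_pos.2 ht
  have hNR : (0 : ℝ) < N := Nat.cast_pos.2 hN
  have hAR : (0 : ℝ) < #A := Nat.cast_pos.2 (ht.trans_le hA)
  rw [sketchEstimate, treeEstimate, if_neg hfull.not_gt]
  rw [← sup_smallest_le_iff_le_hashCount hinj ht hA] at hhigh
  rw [← not_le, ← sup_smallest_le_iff_le_hashCount hinj ht hA, not_le] at hlow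
  set l : ℝ := (((smallest t (A.image h)).sup id : ℕ) : ℝ)
  have hl : 0 < l := lt_trans (by positivity) hlow
  rw [div_lt_iff₀ (by positivity)] at hlow
  rw [le_div_iff₀ (by positivity)] at hhigh
  constructor
  · rw [le_div_iff₀ hl]
    linarith
  · rw [div_le_iff₀ hl]
    linarith

end SketchAccuracy

section SecondMoment

variable {α ω : Type*} {Ω : Finset ω}

theorem card_filter_mul_sq_le {X : ω → ℝ} {r : ℝ} (hr : 0 ≤ r) :
    #(Ω.filter fun i => r ≤ |X i|) * r ^ 2 ≤ ∑ i ∈ Ω, X i ^ 2 := by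
  calc #(Ω.filter fun i => r ≤ |X i|) * r ^ 2 = ∑ _i ∈ Ω.filter fun i => r ≤ |X i|, r ^ 2 := by
        rw [sum_const, nsmul_eq_mul]
    _ ≤ ∑ i ∈ Ω.filter fun i => r ≤ |X i|, X i ^ 2 := sum_le_sum fun i hi => by
        rw [← sq_abs (X i)]
        exact pow_le_pow_left₀ hr (mem_filter.1 hi).2 2
    _ ≤ ∑ i ∈ Ω, X i ^ 2 :=
        sum_le_sum_of_subset_of_nonneg (filter_subset _ _) fun _ _ _ => sq_nonneg _

/-- Expanding the square of the sum of the centred indicators, pairwise independence kills every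
off-diagonal term. -/
theorem sum_sq_card_filter_sub_le {A : Finset α} {E : α → ω → Prop}
    [∀ i, DecidablePred fun a => E a i] {p : ℝ}
    (hprob : ∀ a ∈ A, (#(Ω.filter (E a)) : ℝ) = #Ω * p)
    (hindep : ∀ a ∈ A, ∀ b ∈ A, a ≠ b →
      (#(Ω.filter fun i => E a i ∧ E b i) : ℝ) = #Ω * p ^ 2) :
    ∑ i ∈ Ω, ((#(A.filter fun a => E a i) : ℝ) - #A * p) ^ 2 ≤ #Ω * (#A * p) := by
  classical
  set X : α → ω → ℝ := fun a i => (if E a i then 1 else 0) - p with hX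
  have hsum : ∀ i, (#(A.filter fun a => E a i) : ℝ) - #A * p = ∑ a ∈ A, X a i := fun i => by
    simp [hX, sum_sub_distrib]
  have hcov : ∀ a b, ∑ i ∈ Ω, X a i * X b i = #(Ω.filter fun i => E a i ∧ E b i) -
      p * #(Ω.filter (E a)) - p * #(Ω.filter (E b)) + #Ω * p ^ 2 := by
    intro a b
    have hexpand : ∀ i, X a i * X b i = (if E a i ∧ E b i then 1 else 0) -
        p * (if E a i then 1 else 0) - p * (if E b i then 1 else 0) + p ^ 2 := fun i => by
      by_cases ha : E a i <;> by_cases hb : E b i <;> simp [hX, ha, hb] <;> ring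
    simp only [hexpand, sum_add_distrib, sum_sub_distrib, ← mul_sum, sum_boole, sum_const,
      nsmul_eq_mul]
  have hoff : ∀ a ∈ A, ∀ b ∈ A, b ≠ a → ∑ i ∈ Ω, X a i * X b i = 0 := fun a ha b hb hba => by
    rw [hcov, hindep a ha b hb hba.symm, hprob a ha, hprob b hb]
    ring
  have hdiag : ∀ a ∈ A, ∑ i ∈ Ω, X a i * X a i ≤ #Ω * p := fun a ha => by
    rw [hcov]
    simp only [and_self, hprob a ha]
    nlinarith [mul_nonneg (Nat.cast_nonneg (α := ℝ) #Ω) (sq_nonneg p)]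
  calc ∑ i ∈ Ω, ((#(A.filter fun a => E a i) : ℝ) - #A * p) ^ 2
      = ∑ a ∈ A, ∑ b ∈ A, ∑ i ∈ Ω, X a i * X b i := by
        simp only [hsum, sq, sum_mul_sum]
        rw [sum_comm]
        exact sum_congr rfl fun a _ => sum_comm
    _ = ∑ a ∈ A, ∑ i ∈ Ω, X a i * X a i := sum_congr rfl fun a ha =>
        sum_eq_single_of_mem a ha (hoff a ha)
    _ ≤ ∑ _a ∈ A, #Ω * p := sum_le_sum hdiag
    _ = #Ω * (#A * p) := by rw [sum_const, nsmul_eq_mul]; ring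

end SecondMoment

namespace TwoUniversalFamily

variable {α : Type*} {N : ℕ} (F : TwoUniversalFamily α N) {A : Finset α} {t : ℕ}

theorem range_pos (F : TwoUniversalFamily α N) [Nonempty α] : 0 < N := by
  obtain ⟨h, hh⟩ := F.nonempty
  obtain ⟨a⟩ := ‹Nonempty α›
  have hmem := mem_Icc.1 (F.mem_range h hh a)
  exact hmem.1.trans hmem.2

theorem card_filter_pair_mem {a b : α} (hab : a ≠ b) {R : Finset (ℕ × ℕ)}
    (hR : R ⊆ Icc 1 N ×ˢ Icc 1 N) :
    #(F.carrier.filter fun h => (h a, h b) ∈ R) * N ^ 2 = #R * #F.carrier := by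
  have hfiber : ∀ q ∈ R,
      #((F.carrier.filter fun h => (h a, h b) ∈ R).filter fun h => (h a, h b) = q) * N ^ 2 =
        #F.carrier := by
    rintro ⟨i, j⟩ hq
    obtain ⟨hi, hj⟩ := mem_product.1 (hR hq)
    rw [← F.pairwise a b hab i hi j hj, filter_filter]
    simp only [Prod.mk.injEq]
    congr 2
    refine filter_congr fun h _ => and_iff_right_of_imp ?_
    rintro ⟨rfl, rfl⟩
    exact hq
  have hmaps : Set.MapsTo (fun h : α → ℕ => (h a, h b))
      (F.carrier.filter fun h => (h a, h b) ∈ R) R := fun h hh => (mem_filter.1 hh).2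
  rw [card_eq_sum_card_fiberwise hmaps, sum_mul, sum_congr rfl hfiber, sum_const, smul_eq_mul]

theorem card_filter_mem [Nontrivial α] (a : α) {P : Finset ℕ} (hP : P ⊆ Icc 1 N) :
    #(F.carrier.filter fun h => h a ∈ P) * N = #P * #F.carrier := by
  obtain ⟨b, hba⟩ := exists_ne a
  have hpair := F.card_filter_pair_mem hba.symm (product_subset_product_left (t := Icc 1 N) hP)
  rw [filter_congr fun h hh => mem_product.trans (and_iff_left (F.mem_range h hh b)),
    card_product, Nat.card_Icc, Nat.add_sub_cancel] at hpair
  refine Nat.eq_of_mul_eq_mul_left F.range_pos ?_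
  linarith

theorem card_filter_collision {a b : α} (hab : a ≠ b) :
    #(F.carrier.filter fun h => h a = h b) * N = #F.carrier := by
  have : Nonempty α := ⟨a⟩
  have hpair := F.card_filter_pair_mem hab
    (R := (Icc 1 N).diag) fun q hq => by
      obtain ⟨h₁, h₂⟩ := mem_diag.1 hq
      exact mem_product.2 ⟨h₁, h₂ ▸ h₁⟩
  rw [diag_card, Nat.card_Icc, Nat.add_sub_cancel,
    filter_congr fun h hh => mem_diag.trans (and_iff_right (F.mem_range h hh a))] at hpair
  refine Nat.eq_of_mul_eq_mul_left F.range_pos ?_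
  linarith

open Classical in
theorem card_not_injOn :
    2 * N * #(F.carrier.filter fun h => ¬ Set.InjOn h A) ≤ (#A * #A - #A) * #F.carrier := by
  set bad := F.carrier.filter fun h => ¬ Set.InjOn h A
  have htwo : ∀ h ∈ bad, 2 ≤ #(A.offDiag.filter fun p => h p.1 = h p.2) := by
    intro h hh
    have hinj := (mem_filter.1 hh).2
    simp only [Set.InjOn, not_forall] at hinj
    obtain ⟨a, ha, b, hb, hab, hne⟩ := hinj
    rw [← card_pair (show (a, b) ≠ (b, a) by simp [hne])]
    refine card_le_card (insert_subset ?_ (singleton_subset_iff.2 ?_))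
    · exact mem_filter.2 ⟨mem_offDiag.2 ⟨ha, hb, hne⟩, hab⟩
    · exact mem_filter.2 ⟨mem_offDiag.2 ⟨hb, ha, Ne.symm hne⟩, hab.symm⟩
  calc 2 * N * #bad = #bad * 2 * N := by ring
    _ ≤ (∑ h ∈ F.carrier, #(A.offDiag.filter fun p => h p.1 = h p.2)) * N := by
        gcongr
        exact (card_nsmul_le_sum _ _ _ htwo).trans (sum_le_sum_of_subset (filter_subset _ _))
    _ = ∑ p ∈ A.offDiag, #(F.carrier.filter fun h => h p.1 = h p.2) * N := by
        rw [← sum_mul]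
        simp only [card_filter]
        rw [sum_comm]
    _ = (#A * #A - #A) * #F.carrier := by
        rw [sum_congr rfl fun p hp => F.card_filter_collision (mem_offDiag.1 hp).2.2, sum_const,
          offDiag_card, smul_eq_mul]

theorem sum_sq_card_filter_mem_sub_le [Nontrivial α] {P : Finset ℕ} (hP : P ⊆ Icc 1 N) :
    ∑ h ∈ F.carrier, ((#(A.filter fun a => h a ∈ P) : ℝ) - #A * (#P / N)) ^ 2 ≤
      #F.carrier * (#A * (#P / N)) := by
  have hN : (0 : ℝ) < N := Nat.cast_pos.2 F.range_pos
  have hprob : ∀ a, (#(F.carrier.filter fun h => h a ∈ P) : ℝ) = #F.carrier * (#P / N) := by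
    intro a
    rw [← mul_div_assoc, eq_div_iff hN.ne', mul_comm (#F.carrier : ℝ)]
    exact_mod_cast F.card_filter_mem a hP
  have hindep : ∀ a b, a ≠ b →
      (#(F.carrier.filter fun h => h a ∈ P ∧ h b ∈ P) : ℝ) = #F.carrier * (#P / N) ^ 2 := by
    intro a b hab
    have hpair := F.card_filter_pair_mem hab (product_subset_product hP hP)
    simp only [mem_product, card_product] at hpair
    rw [div_pow, ← mul_div_assoc, eq_div_iff (by positivity), mul_comm (#F.carrier : ℝ),
      sq (#P : ℝ)]
    exact_mod_cast hpair
  exact sum_sq_card_filter_sub_le (Ω := F.carrier) (A := A) (p := #P / N)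
    (E := fun a h => h a ∈ P) (fun a _ => hprob a) fun a _ b _ hab => hindep a b hab

theorem hashCount_eq_card_filter_mem {h : α → ℕ} (hh : h ∈ F.carrier) {x : ℝ} (hx : 0 ≤ x) :
    hashCount h A x = #(A.filter fun a => h a ∈ Icc 1 ⌊x⌋₊) := by
  rw [hashCount]
  congr 1
  refine filter_congr fun a _ => ?_
  rw [mem_Icc, and_iff_right (mem_Icc.1 (F.mem_range h hh a)).1, Nat.le_floor_iff hx]

theorem card_filter_le_abs_hashCount_sub [Nontrivial α] {x r : ℝ} (hx : 0 ≤ x) (hxN : x ≤ N)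
    (hr : 0 ≤ r) :
    #(F.carrier.filter fun h => r ≤ |(hashCount h A x : ℝ) - #A * (⌊x⌋₊ / N)|) * r ^ 2 ≤
      #F.carrier * (#A * (⌊x⌋₊ / N)) := by
  refine (card_filter_mul_sq_le hr).trans ?_
  rw [sum_congr rfl fun h hh => by rw [F.hashCount_eq_card_filter_mem hh hx]]
  have hbound := F.sum_sq_card_filter_mem_sub_le (A := A)
    (Icc_subset_Icc_right (a := 1) (Nat.floor_le_of_le hxN))
  rwa [Nat.card_Icc, Nat.add_sub_cancel] at hbound

/-- The expected count is at most `3t/4`, so such a hash function deviates by at least `t/4`. -/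
theorem card_le_hashCount_low [Nontrivial α] (ht : 0 < t) (hA : t ≤ #A) :
    (t : ℝ) * #(F.carrier.filter fun h => t ≤ hashCount h A (3 * t * N / (4 * #A))) ≤
      12 * #F.carrier := by
  have hN : (0 : ℝ) < N := Nat.cast_pos.2 F.range_pos
  have htR : (0 : ℝ) < t := Nat.cast_pos.2 ht
  have hAR : (t : ℝ) ≤ #A := Nat.cast_le.2 hA
  have hA0 : (0 : ℝ) < #A := htR.trans_le hAR
  set x : ℝ := 3 * t * N / (4 * #A) with hxdef
  have hx : 0 ≤ x := by positivity
  have hxN : x ≤ N := by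
    rw [hxdef, div_le_iff₀ (by positivity)]
    nlinarith
  have hmean : #A * (⌊x⌋₊ / N : ℝ) ≤ 3 * t / 4 := by
    calc #A * (⌊x⌋₊ / N : ℝ) ≤ #A * (x / N) := by gcongr; exact Nat.floor_le hx
      _ = 3 * t / 4 := by rw [hxdef]; field_simp
  have hdev := (F.card_filter_le_abs_hashCount_sub (A := A) hx hxN
    (show (0 : ℝ) ≤ t / 4 by positivity)).trans (mul_le_mul_of_nonneg_left hmean (by positivity))
  have hsub : #(F.carrier.filter fun h => t ≤ hashCount h A x) ≤
      #(F.carrier.filter fun h => (t / 4 : ℝ) ≤ |(hashCount h A x : ℝ) - #A * (⌊x⌋₊ / N)|) := by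
    refine card_le_card (monotone_filter_right _ fun h _ hcount => ?_)
    have hcountR : (t : ℝ) ≤ hashCount h A x := Nat.cast_le.2 hcount
    exact le_trans (by linarith) (le_abs_self _)
  have hsubR := mul_le_mul_of_nonneg_right (Nat.cast_le (α := ℝ).2 hsub) (sq_nonneg (t / 4 : ℝ))
  refine le_of_mul_le_mul_left ?_ htR
  linarith

/-- The expected count is at least `3t/2 - 1`, so such a hash function deviates by at least
`t/4`. -/
theorem card_hashCount_high_lt [Nontrivial α] (ht : 4 ≤ t) (hA : t ≤ #A) (hAN : #A ≤ N) :
    (t : ℝ) * #(F.carrier.filter fun h => hashCount h A (3 * t * N / (2 * #A)) < t) ≤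
      24 * #F.carrier := by
  have hN : (0 : ℝ) < N := Nat.cast_pos.2 F.range_pos
  have htR : (4 : ℝ) ≤ t := by exact_mod_cast ht
  have hANR : (#A : ℝ) ≤ N := Nat.cast_le.2 hAN
  have hA0 : (0 : ℝ) < #A := Nat.cast_pos.2 (by lia)
  set x : ℝ := 3 * t * N / (2 * #A) with hxdef
  have hx : 0 ≤ x := by positivity
  rcases lt_or_ge (N : ℝ) x with hNx | hxN
  · have hcount : ∀ h ∈ F.carrier, hashCount h A x = #A := fun h hh => by
      refine congrArg card (filter_true_of_mem fun a _ => le_trans ?_ hNx.le)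
      exact_mod_cast (mem_Icc.1 (F.mem_range h hh a)).2
    rw [filter_false_of_mem fun h hh => (hcount h hh).symm ▸ hA.not_gt]
    simp
  have hmean : #A * (⌊x⌋₊ / N : ℝ) ≤ 3 * t / 2 := by
    calc #A * (⌊x⌋₊ / N : ℝ) ≤ #A * (x / N) := by gcongr; exact Nat.floor_le hx
      _ = 3 * t / 2 := by rw [hxdef]; field_simp
  have hmean' : 3 * t / 2 - 1 ≤ #A * (⌊x⌋₊ / N : ℝ) := by
    calc (3 * t / 2 - 1 : ℝ) ≤ 3 * t / 2 - #A / N := by gcongr; exact (div_le_one hN).2 hANR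
      _ = #A * ((x - 1) / N) := by rw [hxdef]; field_simp
      _ ≤ #A * (⌊x⌋₊ / N : ℝ) := by gcongr; exact (Nat.sub_one_lt_floor x).le
  have hdev := (F.card_filter_le_abs_hashCount_sub (A := A) hx hxN
    (show (0 : ℝ) ≤ t / 4 by positivity)).trans (mul_le_mul_of_nonneg_left hmean (by positivity))
  have hsub : #(F.carrier.filter fun h => hashCount h A x < t) ≤
      #(F.carrier.filter fun h => (t / 4 : ℝ) ≤ |(hashCount h A x : ℝ) - #A * (⌊x⌋₊ / N)|) := by
    refine card_le_card (monotone_filter_right _ fun h _ hcount => ?_)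
    have hcountR : (hashCount h A x : ℝ) < t := Nat.cast_lt.2 hcount
    exact le_trans (by linarith) (neg_le_abs _)
  have hsubR := mul_le_mul_of_nonneg_right (Nat.cast_le (α := ℝ).2 hsub) (sq_nonneg (t / 4 : ℝ))
  refine le_of_mul_le_mul_left ?_ (show (0 : ℝ) < t by linarith)
  linarith

open Classical in
theorem card_not_injOn_of_cube_le (hA : #A ^ 3 ≤ N) :
    2 * #A * #(F.carrier.filter fun h => ¬ Set.InjOn h A) ≤ #F.carrier ∧
      8 * #(F.carrier.filter fun h => ¬ Set.InjOn h A) ≤ #F.carrier := by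
  set bad := #(F.carrier.filter fun h => ¬ Set.InjOn h A)
  rcases Nat.eq_zero_or_pos #A with hzero | hpos
  · have : bad = 0 := by
      refine card_eq_zero.2 (filter_false_of_mem fun h _ => not_not.2 ?_)
      simp [card_eq_zero.1 hzero]
    simp [this]
  have hcoll : 2 * #A ^ 3 * bad ≤ (#A * #A - #A) * #F.carrier :=
    (by gcongr : 2 * #A ^ 3 * bad ≤ 2 * N * bad).trans F.card_not_injOn
  constructor
  · refine Nat.le_of_mul_le_mul_left ?_ (pow_pos hpos 2)
    calc #A ^ 2 * (2 * #A * bad) = 2 * #A ^ 3 * bad := by ring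
      _ ≤ (#A * #A - #A) * #F.carrier := hcoll
      _ ≤ #A ^ 2 * #F.carrier := by
        rw [sq]
        exact Nat.mul_le_mul_right _ (Nat.sub_le _ _)
  · have hcube : 4 * (#A * #A - #A) ≤ #A ^ 3 := by
      zify [Nat.le_mul_self #A]
      nlinarith [mul_nonneg (Nat.cast_nonneg (α := ℤ) #A) (sq_nonneg ((#A : ℤ) - 2))]
    refine Nat.le_of_mul_le_mul_left ?_ (pow_pos hpos 3)
    calc #A ^ 3 * (8 * bad) = 4 * (2 * #A ^ 3 * bad) := by ring
      _ ≤ 4 * ((#A * #A - #A) * #F.carrier) := by gcongr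
      _ = 4 * (#A * #A - #A) * #F.carrier := by ring
      _ ≤ #A ^ 3 * #F.carrier := by gcongr

open Classical in
theorem card_not_accurate_le (ht : 300 ≤ t) (hA : #A ^ 3 ≤ N) :
    8 * #(F.carrier.filter fun h => ¬ Accurate (sketchEstimate t N h A) #A) ≤ #F.carrier := by
  set bad := F.carrier.filter fun h => ¬ Accurate (sketchEstimate t N h A) #A
  set nonInj := F.carrier.filter fun h => ¬ Set.InjOn h A
  obtain ⟨hinj, hinj'⟩ := F.card_not_injOn_of_cube_le hA
  rcases lt_or_ge #A t with hlt | hge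
  · have hsub : bad ⊆ nonInj := monotone_filter_right _ fun h _ hbad hinj =>
      hbad (accurate_sketchEstimate_of_card_lt hinj hlt)
    exact (Nat.mul_le_mul_left 8 (card_le_card hsub)).trans hinj'
  obtain ⟨a, -, b, -, hab⟩ := one_lt_card.1 (by lia : 1 < #A)
  have : Nontrivial α := ⟨a, b, hab⟩
  set low := F.carrier.filter fun h => t ≤ hashCount h A (3 * t * N / (4 * #A))
  set high := F.carrier.filter fun h => hashCount h A (3 * t * N / (2 * #A)) < t
  have hsub : bad ⊆ nonInj ∪ low ∪ high := fun h hh => by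
    obtain ⟨hF, hbad⟩ := mem_filter.1 hh
    by_contra hgood
    simp only [nonInj, low, high, mem_union, mem_filter, not_or, not_and, not_not, not_le, not_lt]
      at hgood
    exact hbad (accurate_sketchEstimate_of_hashCount (hgood.1.1 hF) (by lia) hge F.range_pos
      (hgood.1.2 hF) (hgood.2 hF))
  have hcard : #bad ≤ #nonInj + #low + #high := (card_le_card hsub).trans
    ((card_union_le _ _).trans (Nat.add_le_add_right (card_union_le _ _) _))
  have hnonInj : t * #nonInj ≤ #F.carrier :=
    (Nat.mul_le_mul_right _ (by lia : t ≤ 2 * #A)).trans hinj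
  have hlow : (t * #low : ℝ) ≤ 12 * #F.carrier := F.card_le_hashCount_low (by lia) hge
  have hhigh : (t * #high : ℝ) ≤ 24 * #F.carrier :=
    F.card_hashCount_high_lt (by lia) hge ((Nat.le_self_pow three_ne_zero _).trans hA)
  norm_cast at hlow hhigh
  nlinarith [Nat.mul_le_mul_left t hcard, Nat.mul_le_mul_right #bad ht]

end TwoUniversalFamily

section Median

variable {k : ℕ} {x : Fin k → ℝ}

theorem countP_ofFn (p : ℝ → Prop) [DecidablePred p] :
    (List.ofFn x).countP (fun y => decide (p y)) = #(univ.filter fun i => p (x i)) := by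
  rw [← Multiset.coe_countP, ← Fin.univ_val_map, Multiset.countP_map]
  rfl

theorem exists_sorted_median_eq (hk : 0 < k) :
    ∃ (l : List ℝ) (hl : l.length = k), l.Perm (List.ofFn x) ∧ l.Pairwise (· ≤ ·) ∧
      median x = l[k / 2] := by
  have hl : ((List.ofFn x).mergeSort fun a b => decide (a ≤ b)).length = k := by simp
  refine ⟨_, hl, List.mergeSort_perm _ _, (List.pairwise_mergeSort (fun a b c hab hbc => ?_)
    (fun a b => ?_) _).imp of_decide_eq_true, List.getD_eq_getElem _ _ _⟩
  · exact decide_eq_true ((of_decide_eq_true hab).trans (of_decide_eq_true hbc))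
  · simpa using le_total a b

theorem length_le_card_of_sublist {l l' : List ℝ} {p : ℝ → Prop} [DecidablePred p]
    (hl : l.Perm (List.ofFn x)) (hsub : l'.Sublist l) (hp : ∀ y ∈ l', p y) :
    l'.length ≤ #(univ.filter fun i => p (x i)) := by
  rw [← countP_ofFn, ← hl.countP_eq,
    ← List.countP_eq_length.2 fun y hy => decide_eq_true (hp y hy)]
  exact hsub.countP_le

theorem le_two_mul_card_le_median (hk : 0 < k) :
    k ≤ 2 * #(univ.filter fun i => x i ≤ median x) := by
  obtain ⟨l, hl, hperm, hsort, hmedian⟩ := exists_sorted_median_eq (x := x) hk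
  have hlow := length_le_card_of_sublist (p := (· ≤ median x)) hperm
    (List.take_sublist (k / 2 + 1) l) fun y hy => by
      obtain ⟨i, hi, rfl⟩ := List.mem_take_iff_getElem.1 hy
      rw [hmedian]
      exact hsort.rel_get_of_le (a := ⟨i, _⟩) (b := ⟨k / 2, _⟩) (by simp; lia)
  rw [List.length_take] at hlow
  lia

theorem le_two_mul_card_median_le (hk : 0 < k) :
    k ≤ 2 * #(univ.filter fun i => median x ≤ x i) := by
  obtain ⟨l, hl, hperm, hsort, hmedian⟩ := exists_sorted_median_eq (x := x) hk
  have hhigh := length_le_card_of_sublist (p := (median x ≤ ·)) hperm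
    (List.drop_sublist (k / 2) l) fun y hy => by
      obtain ⟨i, hi, rfl⟩ := List.mem_drop_iff_getElem.1 hy
      rw [hmedian]
      exact hsort.rel_get_of_le (a := ⟨k / 2, _⟩) (b := ⟨_, _⟩) (by simp)
  rw [List.length_drop] at hhigh
  lia

open Classical in
theorem le_two_mul_card_not_accurate {s : ℕ} (hk : 0 < k) (h : ¬ Accurate (median x) s) :
    k ≤ 2 * #(univ.filter fun i => ¬ Accurate (x i) s) := by
  rcases not_and_or.1 h with hlow | hhigh
  · refine (le_two_mul_card_le_median (x := x) hk).trans (Nat.mul_le_mul_left 2 (card_le_card ?_))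
    exact monotone_filter_right _ fun i _ hi hacc => hlow (hacc.1.trans hi)
  · refine (le_two_mul_card_median_le (x := x) hk).trans (Nat.mul_le_mul_left 2 (card_le_card ?_))
    exact monotone_filter_right _ fun i _ hi hacc => hhigh (hi.trans hacc.2)

/-- Chernoff: give every bad element weight `9` and every other element weight `1`. A tuple with
a bad majority then has weight at least `3 ^ k`, and the total weight of all tuples is at most
`(2 * #K) ^ k`. -/
theorem card_bad_majority_le {β : Type*} {K : Finset β} {bad : β → Prop} [DecidablePred bad]
    (hbad : 8 * #(K.filter bad) ≤ #K) :
    (#((Fintype.piFinset fun _ : Fin k => K).filter fun h =>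
      k ≤ 2 * #(univ.filter fun i => bad (h i))) : ℝ) ≤ (2 / 3) ^ k * (#K : ℝ) ^ k := by
  classical
  set w : β → ℝ := fun b => if bad b then 9 else 1 with hw
  have hw_nonneg : ∀ b, 0 ≤ w b := fun b => by
    simp only [hw]
    split_ifs <;> norm_num
  have hsum : ∑ b ∈ K, w b ≤ 2 * #K := by
    have hbadR : (8 : ℝ) * #(K.filter bad) ≤ #K := by exact_mod_cast hbad
    rw [sum_ite, sum_const, sum_const, nsmul_eq_mul, nsmul_eq_mul, filter_not,
      card_sdiff_of_subset (filter_subset _ _), Nat.cast_sub (card_filter_le _ _)]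
    linarith
  have hprod : ∀ h : Fin k → β, ∏ i, w (h i) = 9 ^ #(univ.filter fun i => bad (h i)) := fun h => by
    rw [prod_ite, prod_const, prod_const_one, mul_one]
  set majority := (Fintype.piFinset fun _ : Fin k => K).filter fun h =>
    k ≤ 2 * #(univ.filter fun i => bad (h i))
  rw [div_pow, div_mul_eq_mul_div, le_div_iff₀ (by positivity), ← mul_pow]
  calc (#majority : ℝ) * 3 ^ k = #majority • (3 : ℝ) ^ k := (nsmul_eq_mul _ _).symm
    _ ≤ ∑ h ∈ majority, ∏ i, w (h i) := card_nsmul_le_sum _ _ _ fun h hh => by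
        rw [hprod, show (9 : ℝ) = 3 ^ 2 by norm_num, ← pow_mul]
        exact pow_le_pow_right₀ (by norm_num) (mem_filter.1 hh).2
    _ ≤ ∑ h ∈ Fintype.piFinset fun _ : Fin k => K, ∏ i, w (h i) :=
        sum_le_sum_of_subset_of_nonneg (filter_subset _ _)
          fun h _ _ => prod_nonneg fun i _ => hw_nonneg (h i)
    _ = (∑ b ∈ K, w b) ^ k := by
        rw [← prod_univ_sum (fun _ : Fin k => K) fun _ b => w b, prod_const, card_univ,
          Fintype.card_fin]
    _ ≤ (2 * #K) ^ k := pow_le_pow_left₀ (sum_nonneg fun b _ => hw_nonneg b) hsum k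

end Median

section Estimates

variable {α ι : Type*} {N t k : ℕ}

theorem drawHashes_not_accurate_le (F : TwoUniversalFamily α N) (ht : 300 ≤ t)
    (hk : 0 < k) {A : Finset α} (hA : #A ^ 3 ≤ N) :
    (drawHashes F k).toOuterMeasure
        {h | ¬ Accurate (median fun i => sketchEstimate t N (h i) A) #A} ≤
      ENNReal.ofReal ((2 / 3) ^ k) := by
  classical
  rw [drawHashes, PMF.toOuterMeasure_uniformOfFinset_apply]
  refine ENNReal.div_le_of_le_mul ?_
  rw [← ENNReal.ofReal_natCast, ← ENNReal.ofReal_natCast (#(Fintype.piFinset _)),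
    ← ENNReal.ofReal_mul (by positivity)]
  refine ENNReal.ofReal_le_ofReal (le_trans (Nat.cast_le.2 (card_le_card ?_))
    ((card_bad_majority_le (F.card_not_accurate_le ht hA)).trans_eq ?_))
  · intro h hh
    simp only [mem_filter, Set.mem_ofPred_eq] at hh ⊢
    exact ⟨hh.1, le_two_mul_card_not_accurate hk hh.2⟩
  · rw [Fintype.card_piFinset_const, Nat.cast_pow]

theorem drawHashes_accurate [Fintype ι] (F : TwoUniversalFamily α N)
    (ht : 300 ≤ t) (hk : 0 < k) {A : ι → Finset α} (hA : ∀ v, #(A v) ^ 3 ≤ N) :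
    (drawHashes F k).toOuterMeasure
        {h | ¬ ∀ v, Accurate (median fun i => sketchEstimate t N (h i) (A v)) #(A v)} ≤
      Fintype.card ι * ENNReal.ofReal ((2 / 3) ^ k) := by
  simp only [not_forall, Set.ofPred_exists]
  refine (MeasureTheory.measure_iUnion_le _).trans ?_
  rw [tsum_fintype, ← card_univ, ← nsmul_eq_mul]
  exact sum_le_card_nsmul _ _ _ fun v _ => drawHashes_not_accurate_le F ht hk (hA v)

variable {V : Type*} [Fintype V]

/-- A bound for the probability that one invocation of an estimation procedure returns an
inaccurate estimate of some vertex. -/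
noncomputable def estimateError (cfg : Config V) : ℝ≥0∞ :=
  Fintype.card V * ENNReal.ofReal ((2 / 3) ^ logCount cfg.c' (Fintype.card V))

theorem logCount_pos {c : ℝ} {n : ℕ} : 0 < logCount c n :=
  lt_max_of_lt_left one_pos

variable [DecidableEq V] {cfg : Config V} {G : Digraph V} {S : Finset V}

theorem estimateV_accurate (ht : 300 ≤ treeSize cfg.c) (hG : Acyclic G) :
    HoldsExcept (OptionT.lift (estimateV cfg G S)) (estimateError cfg)
      fun nV => ∀ v, Accurate (nV v) #(anc G S v) := by
  refine HoldsExcept.lift ?_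
  rw [estimateV, PMF.toOuterMeasure_map_apply]
  simp only [vertexTrees_eq hG]
  exact drawHashes_accurate cfg.hashV ht logCount_pos
    fun v => Nat.pow_le_pow_left (card_le_univ (anc G S v)) 3

theorem estimateE_accurate (ht : 300 ≤ treeSize cfg.c) (hG : Acyclic G) :
    HoldsExcept (OptionT.lift (estimateE cfg G S)) (estimateError cfg)
      fun nE => ∀ v, Accurate (nE v) #(edgesIn G (anc G S v)) := by
  refine HoldsExcept.lift ?_
  rw [estimateE, PMF.toOuterMeasure_map_apply]
  simp only [edgeTrees_eq hG]
  exact drawHashes_accurate cfg.hashE ht logCount_pos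
    fun v => Nat.pow_le_pow_left (card_le_univ (edgesIn G (anc G S v))) 3

end Estimates

section SmallSubgraphs

variable {V : Type*} {G : Digraph V} {R X : Finset V} {p : V → Prop}

/-- `X` is the largest subset of `R` that is closed under predecessors in `R` and all of whose
elements satisfy `p`, characterised by the fact that no further element can be added. -/
structure IsMaximalClosed (G : Digraph V) (p : V → Prop) (R X : Finset V) : Prop where
  subset : X ⊆ R
  holds : ∀ v ∈ X, p v
  pred_subset : ∀ v ∈ X, pred G R v ⊆ X
  mem : ∀ w ∈ R, pred G R w ⊆ X → p w → w ∈ X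

theorem IsMaximalClosed.mem_of_card_anc_le [DecidableEq V] (hX : IsMaximalClosed G p R X)
    (hG : Acyclic G) {k : ℕ} (hp : ∀ w ∈ R, #(anc G R w) ≤ k → p w) {w : V} (hw : w ∈ R)
    (hk : #(anc G R w) ≤ k) : w ∈ X := by
  induction hcard : #(anc G R w) using Nat.strong_induction_on generalizing w with
  | _ m ih =>
    refine hX.mem w hw (fun u hu => ?_) (hp w hw hk)
    have hlt := hG.card_anc_lt_of_mem_pred hw hu
    exact ih _ (hcard ▸ hlt) (mem_pred.1 hu).1 (hlt.le.trans hk) rfl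

theorem IsMaximalClosed.nonempty [DecidableEq V] (hX : IsMaximalClosed G p R X)
    (hG : Acyclic G) (hp : ∀ w ∈ R, #(anc G R w) ≤ 1 → p w) (hR : R.Nonempty) : X.Nonempty := by
  obtain ⟨w, hw, hmin⟩ := exists_min_image R (fun v => #(anc G R v)) hR
  have hpred : pred G R w = ∅ := eq_empty_of_forall_notMem fun u hu =>
    (hmin u (mem_pred.1 hu).1).not_gt (hG.card_anc_lt_of_mem_pred hw hu)
  refine ⟨w, hX.mem_of_card_anc_le hG hp hw ?_⟩
  simp [anc_eq_insert_biUnion_pred hw, hpred]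

/-- The invariant of the queue that builds `X`: every element of `R \ X` that could be added
to `X` is waiting in the queue `Q`. -/
structure QueueInvariant (G : Digraph V) (p : V → Prop) (R : Finset V) (Q : List V)
    (X : Finset V) : Prop where
  nodup : Q.Nodup
  mem_of_mem_queue : ∀ w ∈ Q, w ∈ R
  pred_subset_of_mem_queue : ∀ w ∈ Q, pred G R w ⊆ X
  notMem_of_mem_queue : ∀ w ∈ Q, w ∉ X
  subset : X ⊆ R
  holds : ∀ v ∈ X, p v
  pred_subset : ∀ v ∈ X, pred G R v ⊆ X
  mem_or_mem_queue : ∀ w ∈ R, pred G R w ⊆ X → p w → w ∈ X ∨ w ∈ Q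

namespace QueueInvariant

variable {Q : List V} {v : V}

theorem sources [DecidableEq V] :
    QueueInvariant G p R (R.filter fun v => pred G R v = ∅).toList ∅ where
  nodup := nodup_toList _
  mem_of_mem_queue _ hw := (mem_filter.1 (mem_toList.1 hw)).1
  pred_subset_of_mem_queue _ hw := (mem_filter.1 (mem_toList.1 hw)).2.subset
  notMem_of_mem_queue w _ := notMem_empty w
  subset := empty_subset R
  holds v hv := absurd hv (notMem_empty v)
  pred_subset v hv := absurd hv (notMem_empty v)
  mem_or_mem_queue _ hw hpred _ :=
    .inr (mem_toList.2 (mem_filter.2 ⟨hw, subset_empty.1 hpred⟩))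

theorem length_le (h : QueueInvariant G p R Q X) : Q.length ≤ #R := by
  classical
  rw [← List.toFinset_card_of_nodup h.nodup]
  exact card_le_card fun w hw => h.mem_of_mem_queue w (List.mem_toFinset.1 hw)

theorem isMaximalClosed (h : QueueInvariant G p R [] X) : IsMaximalClosed G p R X where
  subset := h.subset
  holds := h.holds
  pred_subset := h.pred_subset
  mem w hw hpred hpw := (h.mem_or_mem_queue w hw hpred hpw).resolve_right List.not_mem_nil

theorem reject (h : QueueInvariant G p R (v :: Q) X) (hv : ¬ p v) :
    QueueInvariant G p R Q X where
  nodup := h.nodup.of_cons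
  mem_of_mem_queue w hw := h.mem_of_mem_queue w (List.mem_cons_of_mem v hw)
  pred_subset_of_mem_queue w hw := h.pred_subset_of_mem_queue w (List.mem_cons_of_mem v hw)
  notMem_of_mem_queue w hw := h.notMem_of_mem_queue w (List.mem_cons_of_mem v hw)
  subset := h.subset
  holds := h.holds
  pred_subset := h.pred_subset
  mem_or_mem_queue w hw hpred hpw := (h.mem_or_mem_queue w hw hpred hpw).imp_right fun hmem =>
    (List.mem_cons.1 hmem).resolve_left (ne_of_apply_ne p fun hwv => hv (hwv.mp hpw))

theorem mem_of_mem_head (h : QueueInvariant G p R (v :: Q) X) : v ∈ R :=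
  h.mem_of_mem_queue v List.mem_cons_self

theorem notMem_of_adj_head (h : QueueInvariant G p R (v :: Q) X) {w : V} (hvw : G.Adj v w)
    (hpred : pred G R w ⊆ X) : False :=
  h.notMem_of_mem_queue v List.mem_cons_self (hpred (mem_pred.2 ⟨h.mem_of_mem_head, hvw⟩))

theorem accept [DecidableEq V] (hG : Acyclic G) (h : QueueInvariant G p R (v :: Q) X) (hv : p v) :
    QueueInvariant G p R (Q ++ ((succ G R v).filter fun w => pred G R w ⊆ insert v X).toList)
      (insert v X) := by
  have htail : ∀ w ∈ Q, w ∈ v :: Q := fun w hw => List.mem_cons_of_mem v hw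
  have hnew : ∀ w ∈ ((succ G R v).filter fun w => pred G R w ⊆ insert v X).toList,
      w ∈ R ∧ G.Adj v w ∧ pred G R w ⊆ insert v X := fun w hw => by
    obtain ⟨hsucc, hpred⟩ := mem_filter.1 (mem_toList.1 hw)
    exact ⟨(mem_succ.1 hsucc).1, (mem_succ.1 hsucc).2, hpred⟩
  refine ⟨?nodup, ?mem, ?pred_queue, ?notMem, insert_subset h.mem_of_mem_head h.subset,
    (forall_mem_insert _ _ _).2 ⟨hv, h.holds⟩, ?pred, fun w hw hpred hpw => ?complete⟩
  case nodup => exact h.nodup.of_cons.append (nodup_toList _) fun w hw hw' =>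
    h.notMem_of_adj_head (hnew w hw').2.1 (h.pred_subset_of_mem_queue w (htail w hw))
  case mem =>
    exact fun w hw => (List.mem_append.1 hw).elim
      (fun hw => h.mem_of_mem_queue w (htail w hw)) fun hw => (hnew w hw).1
  case pred_queue =>
    exact fun w hw => (List.mem_append.1 hw).elim
      (fun hw => (h.pred_subset_of_mem_queue w (htail w hw)).trans (subset_insert v X))
      fun hw => (hnew w hw).2.2
  case notMem =>
    refine fun w hw => (List.mem_append.1 hw).elim (fun hw' hmem => ?_) fun hw' hmem => ?_
    · rcases mem_insert.1 hmem with rfl | hmem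
      · exact (List.nodup_cons.1 h.nodup).1 hw'
      · exact h.notMem_of_mem_queue w (htail w hw') hmem
    · rcases mem_insert.1 hmem with rfl | hmem
      · exact hG.not_adj_self (hnew w hw').2.1
      · exact h.notMem_of_adj_head (hnew w hw').2.1 (h.pred_subset w hmem)
  case pred =>
    refine fun w hw => subset_trans ?_ (subset_insert v X)
    rcases mem_insert.1 hw with rfl | hw
    · exact h.pred_subset_of_mem_queue w List.mem_cons_self
    · exact h.pred_subset w hw
  case complete =>
    by_cases hvw : G.Adj v w
    · exact .inr (List.mem_append_right _ (mem_toList.2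
        (mem_filter.2 ⟨mem_succ.2 ⟨hw, hvw⟩, hpred⟩)))
    · have hpred' : pred G R w ⊆ X := (subset_insert_iff_of_notMem fun hmem =>
        hvw (mem_pred.1 hmem).2).1 hpred
      rcases h.mem_or_mem_queue w hw hpred' hpw with hmem | hmem
      · exact .inl (mem_insert_of_mem hmem)
      · rcases List.mem_cons.1 hmem with rfl | hmem
        · exact .inl (mem_insert_self _ _)
        · exact .inr (List.mem_append_left _ hmem)

end QueueInvariant

theorem buildSmall_isMaximalClosed [DecidableEq V] (hG : Acyclic G) {ρ fuel : ℕ} {nV : V → ℝ}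
    (hfuel : (#R + 1) * #R + #R ≤ fuel) :
    HoldsExcept (buildSmall G ρ nV fuel R) 0 fun q =>
      IsMaximalClosed G (fun v => nV v ≤ 4 / 3 * (ρ : ℝ)) R q.2 := by
  set p : V → Prop := fun v => nV v ≤ 4 / 3 * (ρ : ℝ)
  -- Accepting an element replaces it in the queue by at most `#R` others.
  set m : List V × Finset V → ℕ := fun st => (#R + 1) * #(R \ st.2) + st.1.length with hm
  refine ((HoldsExcept.whileLoop (δ := 0) (fun st => QueueInvariant G p R st.1 st.2) m
    ?step (fun st _ hQ => Nat.add_pos_right _ (List.length_pos_iff.2 hQ))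
    QueueInvariant.sources ?start).mono_prob (by simp)).mono ?exit
  case start =>
    refine le_trans ?_ hfuel
    simp only [hm, sdiff_empty]
    exact Nat.add_le_add_left (QueueInvariant.sources (G := G) (p := p)).length_le _
  case exit =>
    rintro ⟨Q, X⟩ ⟨hinv, hQ⟩
    obtain rfl : Q = [] := not_not.1 hQ
    exact hinv.isMaximalClosed
  case step =>
    rintro ⟨_ | ⟨v, Q⟩, X⟩ hinv hQ
    · exact absurd rfl hQ
    refine HoldsExcept.ite (fun hpass => HoldsExcept.pure ⟨hinv.accept hG hpass, ?_⟩)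
      fun hfail => HoldsExcept.pure ⟨hinv.reject hfail, ?_⟩
    · have hcard : #(R \ insert v X) + 1 = #(R \ X) := by
        rw [sdiff_insert, card_erase_add_one (mem_sdiff.2
          ⟨hinv.mem_of_mem_head, hinv.notMem_of_mem_queue v List.mem_cons_self⟩)]
      have hlength := (hinv.accept hG hpass).length_le
      simp only [hm, ← hcard, List.length_cons]
      lia
    · simp [hm]

end SmallSubgraphs

section Partition

variable {V : Type*} {G : Digraph V} {M ρ : ℕ} {σ : Schedule V M}

theorem le_makespan {m : Fin M} {v : V} {t : ℕ} (h : (m, v, t) ∈ σ) : t ≤ makespan σ :=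
  le_sup (f := fun p : Fin M × V × ℕ => p.2.2) h

theorem IsFeasible.card_le [Fintype V] (hσ : IsFeasible G ρ σ) :
    Fintype.card V ≤ M * makespan σ := by
  choose μ τ hμτ using hσ.all_jobs
  have hcard := card_le_card_of_injOn (s := (univ : Finset V))
    (t := (univ : Finset (Fin M)) ×ˢ Icc 1 (makespan σ)) (fun v => (μ v, τ v))
    (fun v _ => by simpa using ⟨hσ.time_pos _ _ _ (hμτ v), le_makespan (hμτ v)⟩)
    (fun u _ v _ huv => by
      obtain ⟨hμ, hτ⟩ := Prod.mk.inj huv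
      exact hσ.one_at_a_time (μ u) (τ u) u v (hμτ u) (by rw [hμ, hτ]; exact hμτ v))
  rwa [card_product, card_univ, card_univ, Fintype.card_fin, Nat.card_Icc,
    Nat.add_sub_cancel] at hcard

variable {R : Finset V}

theorem IsFeasible.exists_le_of_mem_anc [DecidableEq V] (hσ : IsFeasible G ρ σ) {s : ℕ}
    (hR : ∀ v ∈ R, ∀ m t, (m, v, t) ∈ σ → s < t) {m : Fin M} {u v : V} {t : ℕ}
    (hm : (m, v, t) ∈ σ) (ht : t ≤ s + ρ) (hu : u ∈ anc G R v) :
    ∃ t' ≤ t, (m, u, t') ∈ σ := by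
  induction (mem_anc.1 hu).2.2 using Relation.ReflTransGen.head_induction_on with
  | refl => exact ⟨t, le_rfl, hm⟩
  | head hab hbv ih =>
    obtain ⟨t₁, ht₁, hm₁⟩ := ih (mem_anc.2 ⟨hab.2.1, mem_of_mem_anc hu, hbv⟩)
    rcases hσ.precedence m _ t₁ hm₁ _ hab.2.2 with ⟨t₂, hm₂, hlt⟩ | ⟨m₂, t₂, -, hm₂, hlt⟩
    · exact ⟨t₂, by lia, hm₂⟩
    · have := hR _ hab.1 m₂ t₂ hm₂
      lia

/-- Within `ρ` slots no result can be communicated, so all ancestors run on one machine. -/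
theorem IsFeasible.lt_of_lt_card_anc [DecidableEq V] (hσ : IsFeasible G ρ σ) {s : ℕ}
    (hR : ∀ v ∈ R, ∀ m t, (m, v, t) ∈ σ → s < t) {v : V} (hv : ρ < #(anc G R v)) {m : Fin M}
    {t : ℕ} (hm : (m, v, t) ∈ σ) : s + ρ < t := by
  by_contra! hle
  have hrun := fun u hu => hσ.exists_le_of_mem_anc (u := u) hR hm hle hu
  choose! τ hτ hτσ using hrun
  have hcard := card_le_card_of_injOn (s := anc G R v) (t := Ioc s t) τ
    (fun u hu => mem_coe.2 (mem_Ioc.2 ⟨hR u (anc_subset hu) m _ (hτσ u hu), hτ u hu⟩))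
    (fun u hu w hw huw => hσ.one_at_a_time m (τ u) u w (hτσ u hu) (huw ▸ hτσ w hw))
  rw [Nat.card_Ioc] at hcard
  lia

variable [DecidableEq V]

/-- A list of small subgraphs that can be scheduled one after the other once `D` is done: all
predecessors of a layer are in `D`, in the layer itself or in an earlier one, and no job has more
than `2 ρ` ancestors in its layer. -/
def Layered (G : Digraph V) (ρ : ℕ) : Finset V → List (Finset V) → Prop
  | _, [] => True
  | D, H :: Hs => (∀ v ∈ H, ∀ u, G.Adj u v → u ∈ H ∨ u ∈ D) ∧ (∀ v ∈ H, #(anc G H v) ≤ 2 * ρ) ∧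
      Layered G ρ (D ∪ H) Hs

theorem Layered.concat {H : Finset V} : ∀ {Hs : List (Finset V)} {D : Finset V},
    Layered G ρ D Hs → Layered G ρ (Hs.foldl (· ∪ ·) D) [H] → Layered G ρ D (Hs ++ [H])
  | [], _, _, hH => hH
  | _ :: _, _, hHs, hH => ⟨hHs.1, hHs.2.1, hHs.2.2.concat hH⟩

variable [Fintype V] {Hs : List (Finset V)} {X : Finset V} {p : V → Prop}

/-- `Hs` is a partition of the complement of `R` into layers, none of which is started too early:
in every feasible schedule each remaining job waits for `ρ` slots per layer. -/
structure IsPartition (G : Digraph V) (ρ : ℕ) (R : Finset V) (Hs : List (Finset V)) : Prop where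
  closed : ∀ u v, v ∉ R → G.Adj u v → u ∉ R
  layered : Layered G ρ ∅ Hs
  cover : Hs.foldl (· ∪ ·) ∅ = univ \ R
  length_add : Hs.length + #R ≤ Fintype.card V
  sum_card : (Hs.map card).sum + #R = Fintype.card V
  late : ∀ (M : ℕ) (σ : Schedule V M), IsFeasible G ρ σ →
    ∀ v ∈ R, ∀ m t, (m, v, t) ∈ σ → Hs.length * ρ < t
  length_mul : ∀ (M : ℕ) (σ : Schedule V M), IsFeasible G ρ σ → Hs.length * ρ ≤ makespan σ + ρ

namespace IsPartition

theorem nil : IsPartition G ρ univ [] where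
  closed _ v hv := absurd (mem_univ v) hv
  layered := trivial
  cover := by simp
  length_add := by simp
  sum_card := by simp
  late M σ hσ v _ m t hm := by simpa using Nat.lt_of_succ_le (hσ.time_pos m v t hm)
  length_mul := by simp

theorem closed_sdiff (h : IsPartition G ρ R Hs) (hX : IsMaximalClosed G p R X) :
    ∀ u v, v ∉ R \ X → G.Adj u v → u ∉ R \ X := by
  intro u v hv huv hu
  obtain ⟨huR, huX⟩ := mem_sdiff.1 hu
  by_cases hvR : v ∈ R
  · have hvX : v ∈ X := of_not_not fun hvX => hv (mem_sdiff.2 ⟨hvR, hvX⟩)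
    exact huX (hX.pred_subset v hvX (mem_pred.2 ⟨huR, huv⟩))
  · exact h.closed u v hvR huv huR

theorem layered_concat (h : IsPartition G ρ R Hs) (hX : IsMaximalClosed G p R X)
    (hle : ∀ w, p w → #(anc G R w) ≤ 2 * ρ) : Layered G ρ ∅ (Hs ++ [X]) := by
  refine h.layered.concat ?_
  rw [h.cover]
  refine ⟨fun v hv u huv => ?_, fun v hv => ?_, trivial⟩
  · by_cases hu : u ∈ R
    · exact .inl (hX.pred_subset v hv (mem_pred.2 ⟨hu, huv⟩))
    · exact .inr (mem_sdiff.2 ⟨mem_univ u, hu⟩)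
  · exact (card_le_card (anc_mono hX.subset)).trans (hle v (hX.holds v hv))

theorem length_concat_mul_le (h : IsPartition G ρ R Hs) (hR : R.Nonempty) (hσ : IsFeasible G ρ σ) :
    (Hs ++ [X]).length * ρ ≤ makespan σ + ρ := by
  obtain ⟨w, hw⟩ := hR
  obtain ⟨m, t, hm⟩ := hσ.all_jobs w
  have hlate := (h.late M σ hσ w hw m t hm).le.trans (le_makespan hm)
  rw [List.length_append, List.length_singleton, add_mul, one_mul]
  lia

theorem concat (h : IsPartition G ρ R Hs) (hG : Acyclic G) (hρ : 0 < ρ) (hR : R.Nonempty)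
    (hX : IsMaximalClosed G p R X) (hsmall : ∀ w ∈ R, #(anc G R w) ≤ ρ → p w)
    (hle : ∀ w, p w → #(anc G R w) ≤ 2 * ρ) :
    IsPartition G ρ (R \ X) (Hs ++ [X]) ∧ #(R \ X) < #R := by
  have hpos : 0 < #X := card_pos.2 (hX.nonempty hG (fun w hw hw1 => hsmall w hw (hw1.trans hρ)) hR)
  have hcard : #(R \ X) + #X = #R := card_sdiff_add_card_eq_card hX.subset
  refine ⟨⟨h.closed_sdiff hX, h.layered_concat hX hle, ?cover, ?length, ?sum,
    fun M σ hσ v hv m t hm => ?late, fun M σ hσ => h.length_concat_mul_le hR hσ⟩, by lia⟩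
  case cover =>
    rw [List.foldl_append, h.cover, List.foldl_cons, List.foldl_nil,
      sdiff_sdiff_eq_sdiff_union (subset_univ X)]
  case length =>
    have := h.length_add
    rw [List.length_append, List.length_singleton]
    lia
  case sum =>
    have := h.sum_card
    rw [List.map_append, List.sum_append, List.map_singleton, List.sum_singleton]
    lia
  case late =>
    obtain ⟨hvR, hvX⟩ := mem_sdiff.1 hv
    have hbig : ρ < #(anc G R v) :=
      not_le.1 fun hle => hvX (hX.mem_of_card_anc_le hG hsmall hvR hle)
    rw [List.length_append, List.length_singleton, add_mul, one_mul]
    exact hσ.lt_of_lt_card_anc (h.late M σ hσ) hbig hm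

end IsPartition

theorem partitionGraph_isPartition {cfg : Config V} (ht : 300 ≤ treeSize cfg.c) (hG : Acyclic G)
    (hρ : 0 < ρ) {fuel : ℕ}
    (hfuel : (Fintype.card V + 1) * Fintype.card V + Fintype.card V ≤ fuel) :
    HoldsExcept (partitionGraph cfg G ρ fuel) (Fintype.card V * estimateError cfg)
      (IsPartition G ρ ∅) := by
  refine HoldsExcept.bind_pure
    (Q := fun r : Finset V × List (Finset V) => IsPartition G ρ r.1 r.2 ∧ ¬ r.1.Nonempty)
    ((HoldsExcept.whileLoop (δ := estimateError cfg)
      (fun st : Finset V × List (Finset V) => IsPartition G ρ st.1 st.2) (fun st => #st.1)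
      ?step ?pos ?start ?fuel).mono_prob ?error) ?exit
  case pos => exact fun _ _ hR => card_pos.2 hR
  case start => exact IsPartition.nil
  case fuel => exact card_univ.trans_le ((Nat.le_add_left _ _).trans hfuel)
  case error => rw [card_univ]
  case exit => exact fun r hr => not_nonempty_iff_eq_empty.1 hr.2 ▸ hr.1
  case step =>
    intro st hinv hR
    have hcard : #st.1 ≤ Fintype.card V := card_le_univ st.1
    refine HoldsExcept.mono_prob ((estimateV_accurate ht hG).bind (δ' := 0) fun nV hnV =>
      HoldsExcept.bind_pure (buildSmall_isMaximalClosed hG (le_trans (by gcongr) hfuel))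
        fun q hq => hinv.concat hG hρ hR hq (fun w _ hw => ?_) fun w hw => ?_) (add_zero _).le
    · have hw' : (#(anc G st.1 w) : ℝ) ≤ ρ := Nat.cast_le.2 hw
      linarith [(hnV w).2]
    · have hw' : (#(anc G st.1 w) : ℝ) ≤ 2 * ρ := by linarith [(hnV w).1]
      exact_mod_cast hw'

end Partition

section ListScheduling

variable {V : Type*} {G : Digraph V} {M ρ start clock : ℕ} {D D' : Set V} {σ τ : Schedule V M}
  {load : Fin M → ℕ}

/-- A block that may be processed contiguously once the jobs in `D` are available: the predecessors
of each of its jobs come earlier in the block or belong to `D`. -/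
def ClosedBlock (G : Digraph V) (D : Set V) (block : List V) : Prop :=
  ∀ (i : ℕ) (v : V), block[i]? = some v → ∀ u, G.Adj u v → u ∈ D ∨ ∃ j < i, block[j]? = some u

/-- A schedule of closed blocks after time `start`, where machine `m` is busy for `load m` slots;
a predecessor outside `D` is processed earlier on the same machine. -/
structure IsBatchSchedule (G : Digraph V) (D : Set V) (start : ℕ) (σ : Schedule V M)
    (load : Fin M → ℕ) : Prop where
  time : ∀ m v t, (m, v, t) ∈ σ → start < t ∧ t ≤ start + load m
  one_at_a_time : ∀ m t u v, (m, u, t) ∈ σ → (m, v, t) ∈ σ → u = v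
  precedence : ∀ m v t, (m, v, t) ∈ σ → ∀ u, G.Adj u v → u ∈ D ∨ ∃ t' < t, (m, u, t') ∈ σ

/-- A schedule containing the jobs in `D` that satisfies the feasibility constraints and ends at
least `ρ` slots before `clock`, so that after `clock` its results are available everywhere. -/
structure IsPartialSchedule (G : Digraph V) (ρ : ℕ) (D : Set V) (σ : Schedule V M) (clock : ℕ) :
    Prop where
  time : ∀ m v t, (m, v, t) ∈ σ → 1 ≤ t ∧ t + ρ ≤ clock
  jobs : ∀ v ∈ D, ∃ m t, (m, v, t) ∈ σ
  one_at_a_time : ∀ m t u v, (m, u, t) ∈ σ → (m, v, t) ∈ σ → u = v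
  precedence : ∀ m v t, (m, v, t) ∈ σ → ∀ u, G.Adj u v →
    (∃ t', (m, u, t') ∈ σ ∧ t' < t) ∨ (∃ m' t', m' ≠ m ∧ (m', u, t') ∈ σ ∧ t' + ρ < t)

namespace IsPartialSchedule

theorem empty : IsPartialSchedule G ρ ∅ (∅ : Schedule V M) clock :=
  ⟨by simp, by simp, by simp, by simp⟩

theorem isFeasible (h : IsPartialSchedule G ρ Set.univ σ clock) : IsFeasible G ρ σ where
  time_pos m v t hm := (h.time m v t hm).1
  all_jobs v := h.jobs v trivial
  one_at_a_time := h.one_at_a_time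
  precedence := h.precedence

theorem makespan_le (h : IsPartialSchedule G ρ D σ clock) : makespan σ ≤ clock :=
  Finset.sup_le fun p hp => (Nat.le_add_right _ ρ).trans (h.time p.1 p.2.1 p.2.2 hp).2

end IsPartialSchedule

variable [DecidableEq V]

theorem one_at_a_time_union (hσ : ∀ m t u v, (m, u, t) ∈ σ → (m, v, t) ∈ σ → u = v)
    (hτ : ∀ m t u v, (m, u, t) ∈ τ → (m, v, t) ∈ τ → u = v)
    (hdisj : ∀ m t u v, (m, u, t) ∈ σ → (m, v, t) ∉ τ) (m : Fin M) (t : ℕ) (u v : V)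
    (hu : (m, u, t) ∈ σ ∪ τ) (hv : (m, v, t) ∈ σ ∪ τ) : u = v := by
  rcases mem_union.1 hu with hu | hu <;> rcases mem_union.1 hv with hv | hv
  · exact hσ m t u v hu hv
  · exact absurd hv (hdisj m t u v hu)
  · exact absurd hu (hdisj m t v u hv)
  · exact hτ m t u v hu hv

theorem mem_placeBlock {m m' : Fin M} {s t : ℕ} {v : V} {block : List V} :
    (m', v, t) ∈ placeBlock m s block ↔ m' = m ∧ ∃ i, block[i]? = some v ∧ t = s + i + 1 := by
  simp only [placeBlock, List.mem_toFinset, List.mem_map, Prod.exists, Prod.mk.injEq,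
    List.mem_zipIdx_iff_getElem?]
  constructor
  · rintro ⟨w, i, hi, rfl, rfl, rfl⟩
    exact ⟨rfl, i, hi, rfl⟩
  · rintro ⟨rfl, i, hi, rfl⟩
    exact ⟨v, i, hi, rfl, rfl, rfl⟩

theorem one_at_a_time_placeBlock {m : Fin M} {s : ℕ} {block : List V} (m' : Fin M) (t : ℕ)
    (u v : V) (hu : (m', u, t) ∈ placeBlock m s block) (hv : (m', v, t) ∈ placeBlock m s block) :
    u = v := by
  obtain ⟨-, i, hi, hti⟩ := mem_placeBlock.1 hu
  obtain ⟨-, j, hj, htj⟩ := mem_placeBlock.1 hv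
  obtain rfl : i = j := by omega
  exact Option.some.inj (hi.symm.trans hj)

theorem IsBatchSchedule.union_placeBlock (h : IsBatchSchedule G D start σ load) {block : List V}
    (hblock : ClosedBlock G D block) (m : Fin M) :
    IsBatchSchedule G D start (σ ∪ placeBlock m (start + load m) block)
      (Function.update load m (load m + block.length)) := by
  refine ⟨fun m' v t hm => ?time, one_at_a_time_union h.one_at_a_time one_at_a_time_placeBlock
    fun m' t u v hu hv => ?disjoint, fun m' v t hm u huv => ?precedence⟩
  case time =>
    rcases mem_union.1 hm with hm | hm
    · obtain ⟨hstart, hend⟩ := h.time m' v t hm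
      have hmono : load ≤ Function.update load m (load m + block.length) :=
        le_update_self_iff.2 (Nat.le_add_right _ _)
      exact ⟨hstart, hend.trans (Nat.add_le_add_left (hmono m') start)⟩
    · obtain ⟨rfl, i, hi, rfl⟩ := mem_placeBlock.1 hm
      have hlt := (List.getElem?_eq_some_iff.1 hi).1
      rw [Function.update_self]
      omega
  case disjoint =>
    obtain ⟨rfl, i, -, rfl⟩ := mem_placeBlock.1 hv
    have hend := (h.time _ _ _ hu).2
    omega
  case precedence =>
    rcases mem_union.1 hm with hm | hm
    · exact (h.precedence m' v t hm u huv).imp_right fun ⟨t', ht', hu⟩ =>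
        ⟨t', ht', mem_union_left _ hu⟩
    · obtain ⟨rfl, i, hi, rfl⟩ := mem_placeBlock.1 hm
      exact (hblock i v hi u huv).imp_right fun ⟨j, hj, hu⟩ => ⟨start + load m' + j + 1, by omega,
        mem_union_right _ (mem_placeBlock.2 ⟨rfl, j, hu, rfl⟩)⟩

theorem IsPartialSchedule.union (h : IsPartialSchedule G ρ D σ clock)
    (hτ : IsBatchSchedule G D clock τ load)
    (hjobs : ∀ v ∈ D', v ∈ D ∨ ∃ m t, (m, v, t) ∈ τ) :
    IsPartialSchedule G ρ D' (σ ∪ τ) (clock + univ.sup load + ρ) := by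
  refine ⟨fun m v t hm => ?time, fun v hv => ?jobs, one_at_a_time_union h.one_at_a_time
    hτ.one_at_a_time fun m t u v hu hv => ?disjoint, fun m v t hm u huv => ?precedence⟩
  case time =>
    rcases mem_union.1 hm with hm | hm
    · have := h.time m v t hm
      omega
    · have := hτ.time m v t hm
      have hload : load m ≤ univ.sup load := le_sup (mem_univ m)
      omega
  case jobs =>
    rcases hjobs v hv with hv | ⟨m, t, hm⟩
    · exact (h.jobs v hv).imp fun m => Exists.imp fun t => mem_union_left _
    · exact ⟨m, t, mem_union_right _ hm⟩
  case disjoint =>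
    have := h.time m u t hu
    have := hτ.time m v t hv
    omega
  case precedence =>
    rcases mem_union.1 hm with hm | hm
    · exact (h.precedence m v t hm u huv).imp
        (Exists.imp fun t' => And.imp_left (mem_union_left _))
        (Exists.imp fun m' => Exists.imp fun t' => And.imp_right (And.imp_left (mem_union_left _)))
    · rcases hτ.precedence m v t hm u huv with hu | ⟨t', ht', hu⟩
      · obtain ⟨m', t', hu⟩ := h.jobs u hu
        have hend := (h.time m' u t' hu).2
        have hstart := (hτ.time m v t hm).1
        by_cases hmm : m' = m
        · exact .inl ⟨t', mem_union_left _ (hmm ▸ hu), by omega⟩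
        · exact .inr ⟨m', t', hmm, mem_union_left _ hu, by omega⟩
      · exact .inl ⟨t', mem_union_right _ hu, ht'⟩

theorem closedBlock_topoSort (hG : Acyclic G) {S : Finset V}
    (hS : ∀ v ∈ S, ∀ u, G.Adj u v → u ∈ S ∨ u ∈ D) (v : V) :
    ClosedBlock G D (topoSort G S (anc G S v)) := by
  intro i w hw u huw
  have hwv : w ∈ anc G S v := mem_topoSort.1 (List.mem_of_getElem? hw)
  refine (hS w (anc_subset hwv) u huw).symm.imp_right fun hu => ?_
  have huw' : u ∈ pred G S w := mem_pred.2 ⟨hu, huw⟩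
  have huv : u ∈ anc G S v := anc_subset_anc hwv (pred_subset_anc (anc_subset hwv) huw')
  obtain ⟨j, hj⟩ := List.mem_iff_getElem?.1 (mem_topoSort.2 huv)
  refine ⟨j, lt_of_not_ge fun hij => ?_, hj⟩
  obtain ⟨hi', rfl⟩ := List.getElem?_eq_some_iff.1 hw
  obtain ⟨hj', rfl⟩ := List.getElem?_eq_some_iff.1 hj
  rcases hij.eq_or_lt with rfl | hlt
  · exact hG.not_adj_self huw
  · exact List.pairwise_iff_getElem.1 (hG.pairwise_topoSort_notMem_pred anc_subset)
      i j hi' hj' hlt huw'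

variable [NeZero M]

/-- The state of `listSchedule` before the largest load is taken: the schedule and the loads. -/
noncomputable def listScheduleLoads (M : ℕ) [NeZero M] (start : ℕ) (blocks : List (List V)) :
    Schedule V M × (Fin M → ℕ) :=
  blocks.foldl (fun st block =>
    (st.1 ∪ placeBlock (leastLoaded st.2) (start + st.2 (leastLoaded st.2)) block,
      Function.update st.2 (leastLoaded st.2) (st.2 (leastLoaded st.2) + block.length)))
    (∅, fun _ => 0)

theorem listSchedule_eq (blocks : List (List V)) :
    listSchedule M start blocks = ((listScheduleLoads M start blocks).1,
      univ.sup (listScheduleLoads M start blocks).2) :=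
  rfl

theorem listScheduleLoads_concat (blocks : List (List V)) (block : List V) :
    listScheduleLoads M start (blocks ++ [block]) =
      let st := listScheduleLoads M start blocks
      (st.1 ∪ placeBlock (leastLoaded st.2) (start + st.2 (leastLoaded st.2)) block,
        Function.update st.2 (leastLoaded st.2) (st.2 (leastLoaded st.2) + block.length)) :=
  List.foldl_concat ..

theorem isBatchSchedule_listScheduleLoads {blocks : List (List V)}
    (hclosed : ∀ block ∈ blocks, ClosedBlock G D block) :
    IsBatchSchedule G D start (listScheduleLoads M start blocks).1
      (listScheduleLoads M start blocks).2 := by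
  induction blocks using List.reverseRecOn with
  | nil => exact ⟨by simp [listScheduleLoads], by simp [listScheduleLoads],
      by simp [listScheduleLoads]⟩
  | append_singleton blocks block ih =>
    rw [List.forall_mem_append, List.forall_mem_singleton] at hclosed
    rw [listScheduleLoads_concat]
    exact (ih hclosed.1).union_placeBlock hclosed.2 _

theorem exists_mem_listScheduleLoads {blocks : List (List V)} {block : List V}
    (hblock : block ∈ blocks) {v : V} (hv : v ∈ block) :
    ∃ m t, (m, v, t) ∈ (listScheduleLoads M start blocks).1 := by
  induction blocks using List.reverseRecOn with
  | nil => exact absurd hblock List.not_mem_nil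
  | append_singleton blocks block' ih =>
    rw [listScheduleLoads_concat]
    rcases List.mem_append.1 hblock with h | h
    · exact (ih h).imp fun m => Exists.imp fun t => mem_union_left _
    · obtain rfl := List.mem_singleton.1 h
      obtain ⟨i, hi⟩ := List.mem_iff_getElem?.1 hv
      exact ⟨_, _, mem_union_right _ (mem_placeBlock.2 ⟨rfl, i, hi, rfl⟩)⟩

theorem sum_listScheduleLoads (blocks : List (List V)) :
    ∑ m, (listScheduleLoads M start blocks).2 m = (blocks.map List.length).sum := by
  induction blocks using List.reverseRecOn with
  | nil => simp [listScheduleLoads]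
  | append_singleton blocks block ih =>
    rw [listScheduleLoads_concat, List.map_append, List.sum_append, List.map_singleton,
      List.sum_singleton, ← ih, sum_update_of_mem (mem_univ _), add_right_comm,
      ← sum_eq_add_sum_sdiff_singleton_of_mem (mem_univ _)]

omit [DecidableEq V] in
theorem mul_load_leastLoaded_le (load : Fin M → ℕ) :
    M * load (leastLoaded load) ≤ ∑ m, load m := by
  simpa using card_nsmul_le_sum univ load (load (leastLoaded load))
    fun m _ => Classical.choose_spec (Finite.exists_min load) m

theorem mul_listScheduleLoads_le {maxLen : ℕ} {blocks : List (List V)}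
    (hlen : ∀ block ∈ blocks, block.length ≤ maxLen) (m : Fin M) :
    M * (listScheduleLoads M start blocks).2 m ≤ (blocks.map List.length).sum + M * maxLen := by
  induction blocks using List.reverseRecOn with
  | nil => simp [listScheduleLoads]
  | append_singleton blocks block ih =>
    rw [List.forall_mem_append, List.forall_mem_singleton] at hlen
    rw [listScheduleLoads_concat, List.map_append, List.sum_append, List.map_singleton,
      List.sum_singleton]
    dsimp only
    set load := (listScheduleLoads M start blocks).2 with hload
    rcases eq_or_ne m (leastLoaded load) with rfl | hm
    · have hleast := mul_load_leastLoaded_le load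
      rw [hload, sum_listScheduleLoads, ← hload] at hleast
      have hblock : M * block.length ≤ M * maxLen := Nat.mul_le_mul_left M hlen.2
      rw [Function.update_self, mul_add]
      omega
    · rw [Function.update_of_ne hm]
      have := ih hlen.1
      omega

theorem IsPartialSchedule.add_batch (hG : Acyclic G) {maxLen : ℕ}
    (h : IsPartialSchedule G ρ D σ clock) {S : Finset V}
    (hS : ∀ v ∈ S, ∀ u, G.Adj u v → u ∈ S ∨ u ∈ D) (hlen : ∀ v ∈ S, #(anc G S v) ≤ maxLen)
    {B : List V} (hB : ∀ v ∈ B, v ∈ S) (hD' : D' ⊆ D ∪ ancOf G S B) :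
    let L := listSchedule M clock (B.map fun v => topoSort G S (anc G S v))
    IsPartialSchedule G ρ D' (σ ∪ L.1) (clock + L.2 + ρ) ∧
      M * L.2 ≤ (B.map fun v => #(anc G S v)).sum + M * maxLen := by
  set blocks := B.map fun v => topoSort G S (anc G S v) with hblocks
  have hclosed : ∀ block ∈ blocks, ClosedBlock G D block :=
    List.forall_mem_map.2 fun v _ => closedBlock_topoSort hG hS v
  have hblocksLen : ∀ block ∈ blocks, block.length ≤ maxLen :=
    List.forall_mem_map.2 fun v hv => length_topoSort.trans_le (hlen v (hB v hv))
  have hsum : (blocks.map List.length).sum = (B.map fun v => #(anc G S v)).sum := by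
    simp only [hblocks, List.map_map, Function.comp_def, length_topoSort]
  rw [listSchedule_eq]
  refine ⟨h.union (isBatchSchedule_listScheduleLoads hclosed) fun v hv => ?jobs, ?load⟩
  case jobs =>
    refine (hD' hv).imp_right fun hv => ?_
    obtain ⟨w, hw, hvw⟩ := mem_ancOf.1 (mem_coe.1 hv)
    exact exists_mem_listScheduleLoads (List.mem_map_of_mem hw) (mem_topoSort.2 hvw)
  case load =>
    obtain ⟨m, -, hm⟩ := exists_mem_eq_sup univ univ_nonempty (listScheduleLoads M clock blocks).2
    rw [hm, ← hsum]
    exact mul_listScheduleLoads_le hblocksLen m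

end ListScheduling

section Batches

variable {V : Type*} [DecidableEq V] {G : Digraph V} {S K : Finset V} {γ : ℝ} {B B' : List V}
  {v : V}

/-- After the removal of the ancestors of `B`, at most a `4γ`-fraction of the ancestors of `v`, or
of the edges that they induce, is left. -/
def Shrunk (G : Digraph V) (S : Finset V) (γ : ℝ) (B : List V) (v : V) : Prop :=
  (#(anc G (S \ ancOf G S B) v) : ℝ) ≤ 4 * γ * #(anc G S v) ∨
    0 < #(edgesIn G (anc G S v)) ∧
      (#(edgesIn G (anc G (S \ ancOf G S B) v)) : ℝ) ≤ 4 * γ * #(edgesIn G (anc G S v))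

/-- The search for a batch is done with `v`: the batch `B` contains `v`, or little is left of `v`
after `B`. -/
def Settled (G : Digraph V) (S : Finset V) (γ : ℝ) (B : List V) (v : V) : Prop :=
  v ∈ B ∨ Shrunk G S γ B v

theorem Shrunk.mono (h : Shrunk G S γ B v) (hB : B ⊆ B') : Shrunk G S γ B' v := by
  have hsub : S \ ancOf G S B' ⊆ S \ ancOf G S B := sdiff_subset_sdiff subset_rfl (ancOf_mono hB)
  exact h.imp (le_trans (Nat.cast_le.2 (card_le_card (anc_mono hsub))))
    (And.imp_right (le_trans (Nat.cast_le.2 (card_le_card (edgesIn_mono (anc_mono hsub))))))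

theorem Settled.mono (h : Settled G S γ B v) (hB : B ⊆ B') : Settled G S γ B' v :=
  h.imp (@hB v) fun hv => hv.mono hB

theorem shrunk_of_not_fresh (hγ : 0 ≤ γ) (h : ¬ Fresh G S γ B v) : Shrunk G S γ B v := by
  rw [Fresh, not_and_or, Classical.not_imp, not_lt, not_lt] at h
  have hfour : ∀ n : ℕ, γ * n ≤ 4 * γ * n := fun n => by
    have : 0 ≤ γ * n := by positivity
    linarith
  refine h.imp (fun hanc => ?_) fun ⟨hne, hedges⟩ => ⟨card_pos.2 hne, ?_⟩
  · exact (Nat.cast_le.2 (card_le_card anc_sdiff_ancOf_subset)).trans (hanc.trans (hfour _))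
  · exact (Nat.cast_le.2 (card_le_card edgesIn_anc_sdiff_ancOf_subset)).trans
      (hedges.trans (hfour _))

theorem not_shrunk (hγ : 4 * γ < 1) (hB : ancOf G S B = ∅) (hv : v ∈ S) : ¬ Shrunk G S γ B v := by
  have hlt : ∀ {n : ℕ}, 0 < n → 4 * γ * n < n := fun hn =>
    mul_lt_of_lt_one_left (Nat.cast_pos.2 hn) hγ
  rw [Shrunk, hB, sdiff_empty, not_or, not_and, not_le, not_le]
  exact ⟨hlt (card_anc_pos hv), hlt⟩

/-- A batch: jobs of `S` whose ancestor sets have total size at most `1 / γ` times the size of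
their union. -/
structure IsBatch (G : Digraph V) (S : Finset V) (γ : ℝ) (B : List V) : Prop where
  mem : ∀ v ∈ B, v ∈ S
  weight : γ * (B.map fun v => #(anc G S v)).sum ≤ #(ancOf G S B)

theorem IsBatch.nil : IsBatch G S γ [] :=
  ⟨fun _ h => absurd h List.not_mem_nil, by simp⟩

theorem IsBatch.concat (h : IsBatch G S γ B) (hv : v ∈ S) (hf : Fresh G S γ B v) :
    IsBatch G S γ (B ++ [v]) := by
  refine ⟨List.forall_mem_append.2 ⟨h.mem, List.forall_mem_singleton.2 hv⟩, ?_⟩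
  rw [ancOf_concat, ← union_sdiff_self_eq_union, card_union_of_disjoint disjoint_sdiff,
    List.map_append, List.sum_append, List.map_singleton, List.sum_singleton, Nat.cast_add,
    Nat.cast_add, mul_add]
  exact add_le_add h.weight hf.1.le

/-- The state of `sampleBucket`, started with bucket `K` and batch `B`. A positive counter of stale
samples guarantees that the bucket got smaller. -/
structure SampleInvariant (G : Digraph V) (S : Finset V) (γ : ℝ) (K : Finset V) (B : List V)
    (r : ℕ × Finset V × List V) : Prop where
  bucket_subset : r.2.1 ⊆ K
  batch_subset : B ⊆ r.2.2
  isBatch : IsBatch G S γ r.2.2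
  settled : ∀ v ∈ K, v ∈ r.2.1 ∨ Settled G S γ r.2.2 v
  progress : 0 < r.1 → r.2.1 ⊂ K

namespace SampleInvariant

variable {r : ℕ × Finset V × List V}

theorem erase_ssubset (h : SampleInvariant G S γ K B r) (hv : v ∈ r.2.1) : r.2.1.erase v ⊂ K :=
  (Finset.erase_ssubset hv).trans_subset h.bucket_subset

theorem fresh (h : SampleInvariant G S γ K B r) (hK : K ⊆ S) (hv : v ∈ r.2.1)
    (hf : Fresh G S γ r.2.2 v) :
    SampleInvariant G S γ K B (0, r.2.1.erase v, r.2.2 ++ [v]) where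
  bucket_subset := (h.erase_ssubset hv).subset
  batch_subset := List.subset_append_of_subset_left _ h.batch_subset
  isBatch := h.isBatch.concat (hK (h.bucket_subset hv)) hf
  settled w hw := by
    rcases eq_or_ne w v with rfl | hwv
    · exact .inr (.inl List.mem_concat_self)
    · exact (h.settled w hw).imp (fun hw => mem_erase.2 ⟨hwv, hw⟩)
        fun hw => hw.mono (List.subset_append_left _ _)
  progress := fun hpos => absurd hpos (lt_irrefl 0)

theorem stale (h : SampleInvariant G S γ K B r) (hγ : 0 ≤ γ) (hv : v ∈ r.2.1)
    (hf : ¬ Fresh G S γ r.2.2 v) :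
    SampleInvariant G S γ K B (r.1 + 1, r.2.1.erase v, r.2.2) where
  bucket_subset := (h.erase_ssubset hv).subset
  batch_subset := h.batch_subset
  isBatch := h.isBatch
  settled w hw := by
    rcases eq_or_ne w v with rfl | hwv
    · exact .inr (.inr (shrunk_of_not_fresh hγ hf))
    · exact (h.settled w hw).imp_left fun hw => mem_erase.2 ⟨hwv, hw⟩
  progress := fun _ => h.erase_ssubset hv

end SampleInvariant

theorem sampleBucket_sampleInvariant (hγ : 0 ≤ γ) {N fuel : ℕ} (hN : 0 < N) (hK : K ⊆ S)
    (hB : IsBatch G S γ B) (hfuel : #K ≤ fuel) :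
    HoldsExcept (sampleBucket G S γ N fuel K B) 0 fun r =>
      SampleInvariant G S γ K B r ∧ (K.Nonempty → r.2.1 ⊂ K) := by
  refine ((HoldsExcept.whileLoop (δ := 0) (SampleInvariant G S γ K B) (fun r => #r.2.1) ?body
    (fun r _ hc => card_pos.2 hc.2) ⟨subset_rfl, List.Subset.refl _, hB, fun v hv => .inl hv,
      fun hpos => absurd hpos (lt_irrefl 0)⟩ hfuel).mono fun r ⟨hr, hc⟩ => ⟨hr, fun hne => ?exit⟩)
    |>.mono_prob (mul_zero _).le
  case body =>
    intro r hr hc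
    classical
    rw [dif_pos hc.2]
    refine (HoldsExcept.lift_uniformOfFinset hc.2).bind_of_zero fun v hv => ?_
    have hlt : #(r.2.1.erase v) < #r.2.1 := card_erase_lt_of_mem hv
    exact HoldsExcept.ite (fun hf => .pure ⟨hr.fresh hK hv hf, hlt⟩)
      fun hf => .pure ⟨hr.stale hγ hv hf, hlt⟩
  case exit =>
    rcases not_and_or.1 hc with hcount | hempty
    · exact hr.progress (hN.trans_le (not_lt.1 hcount))
    · rw [not_nonempty_iff_eq_empty.1 hempty]
      exact hne.empty_ssubset

/-- The state of `findBatch`: the buckets and the batch. Bucket `i` only holds jobs of index `i`. -/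
structure BatchInvariant (G : Digraph V) (S : Finset V) (γ : ℝ) (index : V → ℕ)
    (st : (ℕ → Finset V) × List V) : Prop where
  isBatch : IsBatch G S γ st.2
  bucket_subset : ∀ i, st.1 i ⊆ {v ∈ S | index v = i}
  settled : ∀ v ∈ S, v ∈ st.1 (index v) ∨ Settled G S γ st.2 v

namespace BatchInvariant

variable {index : V → ℕ} {st : (ℕ → Finset V) × List V}

theorem init : BatchInvariant G S γ index (fun i => {v ∈ S | index v = i}, []) where
  isBatch := IsBatch.nil
  bucket_subset _ := subset_rfl
  settled _ hv := .inl (mem_filter.2 ⟨hv, rfl⟩)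

theorem bucket_subset_univ (h : BatchInvariant G S γ index st) (i : ℕ) : st.1 i ⊆ S :=
  (h.bucket_subset i).trans (filter_subset _ _)

theorem update (h : BatchInvariant G S γ index st) {i : ℕ} {r : ℕ × Finset V × List V}
    (hr : SampleInvariant G S γ (st.1 i) st.2 r) :
    BatchInvariant G S γ index (Function.update st.1 i r.2.1, r.2.2) where
  isBatch := hr.isBatch
  bucket_subset j := by
    rcases eq_or_ne j i with rfl | hj
    · exact (Function.update_self j _ st.1).subset.trans
        (hr.bucket_subset.trans (h.bucket_subset j))
    · exact (Function.update_of_ne hj _ st.1).subset.trans (h.bucket_subset j)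
  settled v hv := by
    refine (h.settled v hv).elim (fun hvK => ?_) fun hvB => .inr (hvB.mono hr.batch_subset)
    dsimp only
    rcases eq_or_ne (index v) i with rfl | hi
    · rw [Function.update_self]
      exact hr.settled v hvK
    · rw [Function.update_of_ne hi]
      exact .inl hvK

theorem filter (h : BatchInvariant G S γ index st) {p : V → Prop} [DecidablePred p]
    (hp : ∀ v ∈ S, ¬ p v → Shrunk G S γ st.2 v) :
    BatchInvariant G S γ index (fun i => {v ∈ st.1 i | p v}, st.2) where
  isBatch := h.isBatch
  bucket_subset i := (filter_subset _ _).trans (h.bucket_subset i)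
  settled v hv := by
    by_cases hpv : p v
    · exact (h.settled v hv).imp_left fun hvK => mem_filter.2 ⟨hvK, hpv⟩
    · exact .inr (.inr (hp v hv hpv))

end BatchInvariant

theorem sampleBuckets_batchInvariant (hγ : 0 ≤ γ) {N fuel : ℕ} (hN : 0 < N) (hfuel : #S ≤ fuel)
    {index : V → ℕ} {st : (ℕ → Finset V) × List V} (hst : BatchInvariant G S γ index st)
    {l : List ℕ} :
    HoldsExcept (l.foldlM (fun (st : (ℕ → Finset V) × List V) i => do
        let r ← sampleBucket G S γ N fuel (st.1 i) st.2
        pure (Function.update st.1 i r.2.1, r.2.2)) st) 0 fun st' =>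
      BatchInvariant G S γ index st' ∧ st'.1 ≤ st.1 ∧
        ∀ i ∈ l, (st.1 i).Nonempty → st'.1 i ⊂ st.1 i := by
  refine (HoldsExcept.foldlM (δ := 0) (fun l₁ (st' : (ℕ → Finset V) × List V) =>
    BatchInvariant G S γ index st' ∧ st'.1 ≤ st.1 ∧
      ∀ i ∈ l₁, (st.1 i).Nonempty → st'.1 i ⊂ st.1 i) ⟨hst, le_rfl, by simp⟩ ?_).mono_prob
        (mul_zero _).le
  rintro l₁ i - st' - ⟨hst', hle, hlt⟩
  have hi := hst'.bucket_subset_univ i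
  refine HoldsExcept.bind_pure (sampleBucket_sampleInvariant hγ hN hi hst'.isBatch
    ((card_le_card hi).trans hfuel)) fun r ⟨hr, hprogress⟩ => ⟨hst'.update hr, ?le, ?lt⟩
  case le =>
    exact (update_le_self_iff.2 hr.bucket_subset).trans hle
  case lt =>
    intro j hj hne
    dsimp only
    rcases eq_or_ne j i with rfl | hji
    · rw [Function.update_self]
      rcases (st'.1 j).eq_empty_or_nonempty with hempty | hne'
      · exact (hempty ▸ hr.bucket_subset).trans_ssubset hne.empty_ssubset
      · exact (hprogress hne').trans_subset (hle j)
    · rw [Function.update_of_ne hji]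
      exact hlt j ((List.mem_append.1 hj).resolve_right (mt List.mem_singleton.1 hji)) hne

theorem Accurate.le_of_div_le {x x' : ℝ} {s s' : ℕ} (h : Accurate x s) (h' : Accurate x' s')
    (hs : 0 < s) (hγ : 0 ≤ γ) (hle : x' / x ≤ 2 * γ) : (s' : ℝ) ≤ 4 * γ * s := by
  have hx : 0 < x := lt_of_lt_of_le (by positivity) h.1
  have hupper := mul_le_mul_of_nonneg_left h.2 hγ
  have hlower := h'.1
  rw [div_le_iff₀ hx] at hle
  linarith

theorem Accurate.pos_of_ne_zero {x : ℝ} {s : ℕ} (h : Accurate x s) (hx : x ≠ 0) : 0 < s := by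
  refine Nat.pos_of_ne_zero ?_
  rintro rfl
  rw [Accurate, Nat.cast_zero, mul_zero, mul_zero] at h
  exact hx (le_antisymm h.2 h.1)

variable [Fintype V] {cfg : Config V}

theorem prune_batchInvariant (ht : 300 ≤ treeSize cfg.c) (hG : Acyclic G) (hγ : 0 ≤ γ)
    {index : V → ℕ} {st : (ℕ → Finset V) × List V} (h : BatchInvariant G S γ index st) :
    HoldsExcept (prune cfg G S γ st.2 st.1) (4 * estimateError cfg) fun K =>
      BatchInvariant G S γ index (K, st.2) ∧ K ≤ st.1 := by
  refine ((estimateV_accurate ht hG).bind fun nV hV => (estimateE_accurate ht hG).bind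
    fun nE hE => (estimateV_accurate ht hG).bind fun nV' hV' =>
      HoldsExcept.bind_pure (estimateE_accurate ht hG) fun nE' hE' =>
        ⟨h.filter fun v hv hstale => ?_, fun i => filter_subset _ _⟩).mono_prob
          (le_of_eq (by ring))
  refine (not_not.1 hstale).imp (fun hratio => ?_) fun ⟨hne, hratio⟩ => ?_
  · exact (hV v).le_of_div_le (hV' v) (card_anc_pos hv) hγ hratio
  · have hpos := (hE v).pos_of_ne_zero hne
    exact ⟨hpos, (hE v).le_of_div_le (hE' v) hpos hγ hratio⟩

theorem findBatch_isBatch (ht : 300 ≤ treeSize cfg.c) (hG : Acyclic G) (hγ : 0 ≤ γ) {fuel : ℕ}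
    (hfuel : Fintype.card V ≤ fuel) :
    HoldsExcept (findBatch cfg G γ fuel S) (Fintype.card V * (4 * estimateError cfg)) fun B =>
      IsBatch G S γ B ∧ ∀ v ∈ S, Settled G S γ B v := by
  refine (HoldsExcept.lift (δ := 0) (Q := fun _ => True) (by simp)).bind_of_zero fun nE _ => ?_
  set index : V → ℕ := fun v => bucketIndex (nE v)
  set waiting : (ℕ → Finset V) × List V → Finset V := fun st => {v ∈ S | v ∈ st.1 (index v)}
  have hcard (st) : #(waiting st) ≤ Fintype.card V := card_le_univ _
  have hmem {st i v} (hst : BatchInvariant G S γ index st) (hv : v ∈ st.1 i) :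
      index v = i ∧ v ∈ waiting st := by
    obtain ⟨hvS, rfl⟩ := mem_filter.1 (hst.bucket_subset i hv)
    exact ⟨rfl, mem_filter.2 ⟨hvS, hv⟩⟩
  refine HoldsExcept.bind_pure
    (Q := fun r => BatchInvariant G S γ index r ∧ ¬ ∃ i, (r.1 i).Nonempty)
    ((HoldsExcept.whileLoop (δ := 4 * estimateError cfg) (BatchInvariant G S γ index)
      (fun st => #(waiting st)) ?body (fun st hst ⟨i, v, hv⟩ => card_pos.2 ⟨v, (hmem hst hv).2⟩)
      .init ((hcard _).trans hfuel)).mono_prob (by gcongr; exact hcard _))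
    fun r ⟨hr, hc⟩ => ⟨hr.isBatch, fun v hv => (hr.settled v hv).resolve_left
      fun hvK => hc ⟨_, v, hvK⟩⟩
  rintro st hst ⟨i, hi⟩
  refine (sampleBuckets_batchInvariant hγ logCount_pos ((card_le_univ S).trans hfuel)
    hst).bind_of_zero fun st' ⟨hst', hle, hlt⟩ =>
      HoldsExcept.bind_pure (prune_batchInvariant ht hG hγ hst') fun K ⟨hK, hKle⟩ => ⟨hK, ?_⟩
  have hitop : i ∈ (List.range (S.sup index + 1)).reverse := by
    obtain ⟨v, hv⟩ := hi
    obtain ⟨hvS, rfl⟩ := mem_filter.1 (hst.bucket_subset i hv)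
    exact List.mem_reverse.2 (List.mem_range.2 (Nat.lt_succ_of_le (le_sup hvS)))
  obtain ⟨v, hv, hvst'⟩ := exists_of_ssubset (hlt i hitop hi)
  obtain ⟨rfl, hvw⟩ := hmem hst hv
  refine card_lt_card (ssubset_iff_of_subset ?_ |>.2 ⟨v, hvw, fun h => ?_⟩)
  · exact monotone_filter_right _ fun w _ hw => hle _ (hKle _ hw)
  · exact hvst' (hKle _ (mem_filter.1 h).2)

end Batches

section Potential

variable {V : Type*} [DecidableEq V] {G : Digraph V} {S : Finset V} {γ : ℝ} {B : List V} {v : V}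

/-- The number of ancestors of `v` times the number of edges they induce. It drops by a factor `4γ`
with every batch; the maximum keeps it away from `0` when there are no edges. -/
noncomputable def potential (G : Digraph V) (γ : ℝ) (S : Finset V) (v : V) : ℝ :=
  #(anc G S v) * max (4 * γ) #(edgesIn G (anc G S v))

theorem le_potential (hγ : 0 ≤ γ) (hv : v ∈ S) : 4 * γ ≤ potential G γ S v :=
  (le_max_left _ _).trans (le_mul_of_one_le_left (by positivity)
    (Nat.one_le_cast.2 (card_anc_pos hv)))

theorem potential_le (hγ : 4 * γ < 1) {ρ : ℕ} (hρ : 0 < ρ) (h : #(anc G S v) ≤ 2 * ρ) :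
    potential G γ S v ≤ 8 * (ρ : ℝ) ^ 3 := by
  have hanc : (#(anc G S v) : ℝ) ≤ 2 * ρ := by exact_mod_cast h
  have hone : (1 : ℝ) ≤ (2 * ρ) ^ 2 := by exact_mod_cast Nat.one_le_pow _ _ (by positivity)
  have hedges : (#(edgesIn G (anc G S v)) : ℝ) ≤ (2 * ρ) ^ 2 := by
    exact_mod_cast (card_edgesIn_le _).trans (Nat.pow_le_pow_left h 2)
  calc potential G γ S v ≤ 2 * ρ * (2 * ρ) ^ 2 :=
        mul_le_mul hanc (max_le (hγ.le.trans hone) hedges) (le_max_of_le_right (by positivity))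
          (by positivity)
    _ = 8 * (ρ : ℝ) ^ 3 := by ring

theorem Shrunk.potential_le (h : Shrunk G S γ B v) (hγ : 0 ≤ γ) :
    potential G γ (S \ ancOf G S B) v ≤ 4 * γ * potential G γ S v := by
  have hanc : anc G (S \ ancOf G S B) v ⊆ anc G S v := anc_mono sdiff_subset
  rcases h with hcard | ⟨hpos, hcard⟩
  · calc potential G γ (S \ ancOf G S B) v
      _ ≤ 4 * γ * #(anc G S v) * max (4 * γ) #(edgesIn G (anc G S v)) := by
        unfold potential
        gcongr
        exact edgesIn_mono hanc
      _ = 4 * γ * potential G γ S v := by rw [potential, mul_assoc]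
  · have hone : (1 : ℝ) ≤ #(edgesIn G (anc G S v)) := Nat.one_le_cast.2 hpos
    have hmax : max (4 * γ) #(edgesIn G (anc G (S \ ancOf G S B) v)) ≤
        4 * γ * max (4 * γ) #(edgesIn G (anc G S v)) :=
      (max_le (le_mul_of_one_le_right (by positivity) hone) hcard).trans
        (by gcongr; exact le_max_right _ _)
    calc potential G γ (S \ ancOf G S B) v
      _ ≤ #(anc G S v) * (4 * γ * max (4 * γ) #(edgesIn G (anc G S v))) := by
        unfold potential
        gcongr
      _ = 4 * γ * potential G γ S v := mul_left_comm _ _ _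

end Potential

section Layer

variable {V : Type*} [DecidableEq V] {G : Digraph V} {H : Finset V} {γ : ℝ} {B : List V}
  {M : ℕ} {ρ : ℕ} {D : Set V} {clock b β : ℕ} {st : Finset V × Schedule V M × ℕ}

/-- The invariant of the loop over the batches of the layer `H`, after `b` batches. The jobs in `D`
have been scheduled before, up to time `clock`. -/
structure LayerInvariant (G : Digraph V) (ρ : ℕ) (γ : ℝ) (D : Set V) (H : Finset V) (clock b : ℕ)
    (st : Finset V × Schedule V M × ℕ) : Prop where
  subset : st.1 ⊆ H
  closed : ∀ v ∈ st.1, ∀ u, G.Adj u v → u ∈ st.1 ∨ u ∈ D ∪ ↑(H \ st.1)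
  schedule : IsPartialSchedule G ρ (D ∪ ↑(H \ st.1)) st.2.1 st.2.2
  potential_le : ∀ v ∈ st.1, potential G γ st.1 v ≤ (4 * γ) ^ b * (8 * (ρ : ℝ) ^ 3)
  clock_le : γ * (M * st.2.2) ≤ γ * (M * clock) + #(H \ st.1) + γ * (M * (3 * ρ * b))

namespace LayerInvariant

theorem init {σ : Schedule V M} (hγ : 4 * γ < 1) (hρ : 0 < ρ)
    (hclosed : ∀ v ∈ H, ∀ u, G.Adj u v → u ∈ H ∨ u ∈ D) (hH : ∀ v ∈ H, #(anc G H v) ≤ 2 * ρ)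
    (hσ : IsPartialSchedule G ρ D σ clock) : LayerInvariant G ρ γ D H clock 0 (H, σ, clock) where
  subset := subset_rfl
  closed := by simpa using hclosed
  schedule := by simpa using hσ
  potential_le v hv := by simpa using CommDelay.potential_le hγ hρ (hH v hv)
  clock_le := by simp

theorem lt (h : LayerInvariant G ρ γ D H clock b st) (hγ : 0 ≤ γ)
    (hβ : (4 * γ) ^ β * (8 * (ρ : ℝ) ^ 3) < 4 * γ) (hb : b ≤ β) (hne : st.1.Nonempty) : b < β := by
  obtain ⟨v, hv⟩ := hne
  refine hb.lt_of_ne fun hbβ => hβ.not_ge ?_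
  exact hbβ ▸ (le_potential hγ hv).trans (h.potential_le v hv)

variable [NeZero M]

theorem step (hG : Acyclic G) (hγ : 0 ≤ γ) (hH : ∀ v ∈ H, #(anc G H v) ≤ 2 * ρ)
    (h : LayerInvariant G ρ γ D H clock b st) (hB : IsBatch G st.1 γ B)
    (hsettled : ∀ v ∈ st.1, Settled G st.1 γ B v) :
    let L := listSchedule M st.2.2 (B.map fun v => topoSort G st.1 (anc G st.1 v))
    LayerInvariant G ρ γ D H clock (b + 1)
      (st.1 \ ancOf G st.1 B, st.2.1 ∪ L.1, st.2.2 + L.2 + ρ) := by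
  intro L
  have hsub : ancOf G st.1 B ⊆ st.1 := ancOf_subset
  have hdone : H \ (st.1 \ ancOf G st.1 B) = H \ st.1 ∪ ancOf G st.1 B := by
    rw [sdiff_sdiff_right', inf_eq_inter, sup_eq_union,
      inter_eq_right.2 (hsub.trans h.subset)]
  have hcard : #(H \ (st.1 \ ancOf G st.1 B)) = #(H \ st.1) + #(ancOf G st.1 B) := by
    rw [hdone, card_union_of_disjoint (disjoint_sdiff_self_left.mono_right hsub)]
  obtain ⟨hschedule, hload⟩ := h.schedule.add_batch
    (D' := D ∪ ↑(H \ (st.1 \ ancOf G st.1 B))) hG h.closed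
    (fun v hv => (card_le_card (anc_mono h.subset)).trans (hH v (h.subset hv))) hB.mem
    (by rw [hdone, coe_union, Set.union_assoc])
  refine ⟨sdiff_subset.trans h.subset, fun v hv u huv => ?_, hschedule, fun v hv => ?_, ?_⟩
  · have hu := h.closed v (mem_sdiff.1 hv).1 u huv
    dsimp only
    rw [hdone]
    simp only [Set.mem_union, mem_coe, mem_union, mem_sdiff] at hu ⊢
    tauto
  · obtain ⟨hvS, hvB⟩ := mem_sdiff.1 hv
    have hshrunk := (hsettled v hvS).resolve_left fun hmem =>
      hvB (mem_ancOf.2 ⟨v, hmem, self_mem_anc hvS⟩)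
    rw [pow_succ', mul_assoc (4 * γ)]
    exact (hshrunk.potential_le hγ).trans (by gcongr; exact h.potential_le v hvS)
  · have hloadR : (M : ℝ) * L.2 ≤ (B.map fun v => #(anc G st.1 v)).sum + M * (2 * ρ) := by
      exact_mod_cast hload
    have hloadγ := mul_le_mul_of_nonneg_left hloadR hγ
    dsimp only
    rw [hcard]
    push_cast
    linarith [hB.weight, h.clock_le]

end LayerInvariant

variable [NeZero M] [Fintype V] {cfg : Config V}

theorem scheduleSmallSubgraph_isPartialSchedule (ht : 300 ≤ treeSize cfg.c) (hG : Acyclic G)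
    (hγ : 0 ≤ γ) (hγ' : 4 * γ < 1) (hρ : 0 < ρ) (hβ : (4 * γ) ^ β * (8 * (ρ : ℝ) ^ 3) < 4 * γ)
    {fuel : ℕ} (hfuel : Fintype.card V ≤ fuel)
    (hclosed : ∀ v ∈ H, ∀ u, G.Adj u v → u ∈ H ∨ u ∈ D) (hH : ∀ v ∈ H, #(anc G H v) ≤ 2 * ρ)
    {σ : Schedule V M} (hσ : IsPartialSchedule G ρ D σ clock) :
    HoldsExcept (scheduleSmallSubgraph cfg G M ρ γ fuel H σ clock)
      (Fintype.card V * (Fintype.card V * (4 * estimateError cfg))) fun r =>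
        IsPartialSchedule G ρ (D ∪ ↑H) r.1 r.2 ∧
          γ * (M * r.2) ≤ γ * (M * clock) + #H + γ * (M * (3 * ρ * β)) := by
  refine HoldsExcept.bind_pure
    (Q := fun st : Finset V × Schedule V M × ℕ =>
      (∃ b ≤ β, LayerInvariant G ρ γ D H clock b st) ∧ ¬ st.1.Nonempty)
    ((HoldsExcept.whileLoop (δ := Fintype.card V * (4 * estimateError cfg))
      (fun st : Finset V × Schedule V M × ℕ => ∃ b ≤ β, LayerInvariant G ρ γ D H clock b st)
      (fun st => #st.1) ?body (fun st _ hne => card_pos.2 hne)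
      ⟨0, Nat.zero_le β, .init hγ' hρ hclosed hH hσ⟩ ((card_le_univ H).trans hfuel)).mono_prob
      (by gcongr; exact card_le_univ H)) ?result
  case body =>
    rintro st ⟨b, hb, hst⟩ hne
    refine HoldsExcept.bind_pure (findBatch_isBatch (S := st.1) ht hG hγ hfuel)
      fun B ⟨hB, hsettled⟩ =>
        ⟨⟨b + 1, hst.lt hγ hβ hb hne, hst.step hG hγ hH hB hsettled⟩, ?_⟩
    refine card_lt_card (sdiff_ssubset ancOf_subset (nonempty_iff_ne_empty.2 fun hempty => ?_))
    obtain ⟨v, hv⟩ := hne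
    refine (hsettled v hv).elim (fun hvB => ?_) (not_shrunk hγ' hempty hv)
    exact notMem_empty v (hempty ▸ mem_ancOf.2 ⟨v, hvB, self_mem_anc hv⟩)
  case result =>
    rintro st ⟨⟨b, hb, hst⟩, hempty⟩
    have hschedule := hst.schedule
    have hclock := hst.clock_le
    rw [not_nonempty_iff_eq_empty.1 hempty, sdiff_empty] at hschedule hclock
    exact ⟨hschedule, hclock.trans (by gcongr)⟩

theorem scheduleLayers_isPartialSchedule (ht : 300 ≤ treeSize cfg.c) (hG : Acyclic G)
    (hγ : 0 ≤ γ) (hγ' : 4 * γ < 1) (hρ : 0 < ρ) (hβ : (4 * γ) ^ β * (8 * (ρ : ℝ) ^ 3) < 4 * γ)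
    {fuel : ℕ} (hfuel : Fintype.card V ≤ fuel) (Hs : List (Finset V)) (D : Finset V)
    (st : Schedule V M × ℕ) (hHs : Layered G ρ D Hs) (hst : IsPartialSchedule G ρ ↑D st.1 st.2) :
    HoldsExcept (Hs.foldlM (fun (st : Schedule V M × ℕ) H =>
        scheduleSmallSubgraph cfg G M ρ γ fuel H st.1 st.2) st)
      (Hs.length * (Fintype.card V * (Fintype.card V * (4 * estimateError cfg)))) fun r =>
        IsPartialSchedule G ρ ↑(Hs.foldl (· ∪ ·) D) r.1 r.2 ∧
          γ * (M * r.2) ≤ γ * (M * st.2) + (Hs.map card).sum +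
            γ * (M * (3 * ρ * β * Hs.length)) := by
  induction Hs generalizing D st with
  | nil => exact .pure ⟨hst, by simp⟩
  | cons H Hs ih =>
    obtain ⟨hclosed, hH, hHs⟩ := hHs
    rw [List.foldlM_cons]
    refine ((scheduleSmallSubgraph_isPartialSchedule ht hG hγ hγ' hρ hβ hfuel hclosed hH hst).bind
      fun r ⟨hr, hclock⟩ => (ih (D ∪ H) r hHs (by rwa [coe_union])).mono
        fun r' ⟨hr', hclock'⟩ => ⟨hr', ?_⟩).mono_prob (le_of_eq ?_)
    · rw [List.length_cons, Nat.cast_succ]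
      ring
    · simp only [List.map_cons, List.sum_cons, List.length_cons, Nat.cast_add, Nat.cast_one]
      linarith [hclock, hclock']

/-- The total work of the layers costs `X / γ`, and their `L` delays cost `3 β (X + ρ)`. -/
theorem le_approximation_mul {M γ clock load ρ β L X : ℝ} (hM : 0 < M) (hγ : 0 < γ) (hρ : 0 ≤ ρ)
    (hβ : 0 ≤ β) (hclock : γ * (M * clock) ≤ load + γ * (M * (3 * ρ * β * L)))
    (hload : load ≤ M * X) (hL : L * ρ ≤ X + ρ) : clock ≤ (1 / γ + 3 * β) * (X + ρ) := by
  have hdelay : 3 * ρ * β * L ≤ 3 * β * (X + ρ) := by nlinarith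
  have hmul : M * γ * clock ≤ M * γ * (X / γ + 3 * β * (X + ρ)) :=
    calc M * γ * clock = γ * (M * clock) := by ring
      _ ≤ M * X + γ * (M * (3 * β * (X + ρ))) := hclock.trans (by gcongr)
      _ = M * γ * (X / γ + 3 * β * (X + ρ)) := by field_simp
  calc clock ≤ X / γ + 3 * β * (X + ρ) := le_of_mul_le_mul_left hmul (by positivity)
    _ ≤ (X + ρ) / γ + 3 * β * (X + ρ) := by gcongr; linarith
    _ = (1 / γ + 3 * β) * (X + ρ) := by ring

/-- A bound on the probability that some estimate of the whole run is inaccurate: there are at most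
`n` layers with at most `n` batches each, and every batch is found in at most `n` rounds with four
invocations of an estimation procedure. -/
noncomputable def totalError {V : Type*} [Fintype V] (cfg : Config V) : ℝ≥0∞ :=
  Fintype.card V * estimateError cfg +
    Fintype.card V * (Fintype.card V * (Fintype.card V * (4 * estimateError cfg)))

theorem scheduleGeneralGraph_isFeasible (ht : 300 ≤ treeSize cfg.c) (hG : Acyclic G)
    (hγ : 0 < γ) (hγ' : 4 * γ < 1) (hρ : 0 < ρ) (hβ : (4 * γ) ^ β * (8 * (ρ : ℝ) ^ 3) < 4 * γ)
    {fuel : ℕ} (hfuel : (Fintype.card V + 1) * Fintype.card V + Fintype.card V ≤ fuel) :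
    HoldsExcept (scheduleGeneralGraph cfg G M ρ γ fuel) (totalError cfg) fun σ =>
      IsFeasible G ρ σ ∧ ∀ σ' : Schedule V M, IsFeasible G ρ σ' →
        (makespan σ : ℝ) ≤ (1 / γ + 3 * β) * (makespan σ' + ρ) := by
  refine (partitionGraph_isPartition ht hG hρ hfuel).bind fun Hs hHs =>
    HoldsExcept.bind_pure ((scheduleLayers_isPartialSchedule (M := M) ht hG hγ.le hγ' hρ hβ
      (le_trans (by lia) hfuel) Hs ∅ (∅, 0) hHs.layered (by simpa using .empty)).mono_prob ?_)
      fun r ⟨hr, hclock⟩ => ?_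
  · gcongr
    exact le_of_add_le_left hHs.length_add
  · rw [hHs.cover, sdiff_empty, coe_univ] at hr
    refine ⟨hr.isFeasible, fun σ' hσ' => ?_⟩
    have hload : ((Hs.map card).sum : ℝ) ≤ M * makespan σ' := by
      rw [← Nat.cast_mul, Nat.cast_le]
      exact (le_of_add_le_left hHs.sum_card.le).trans hσ'.card_le
    refine (Nat.cast_le.2 hr.makespan_le).trans (le_approximation_mul (M := M) (L := Hs.length)
      (Nat.cast_pos.2 (NeZero.pos M)) hγ (Nat.cast_nonneg ρ) (Nat.cast_nonneg β)
      (by simpa using hclock) hload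
      (by exact_mod_cast hHs.length_mul M σ' hσ'))

end Layer

section Parameters

theorem log_four_le {x : ℝ} (hx : 256 ≤ x) : 4 * Real.log 4 ≤ Real.log x := by
  have h : Real.log ((4 : ℝ) ^ 4) ≤ Real.log x :=
    Real.log_le_log (by norm_num) (by norm_num; exact hx)
  simpa [Real.log_pow] using h

theorem four_div_sqrt_le {x : ℝ} (hx : 256 ≤ x) :
    4 * (1 / √x) ≤ Real.exp (-(Real.log x / 4)) := by
  have hx0 : 0 < x := by linarith
  calc 4 * (1 / √x) = Real.exp (Real.log 4 - Real.log x / 2) := by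
        rw [Real.exp_sub, Real.exp_log (by norm_num), ← Real.log_sqrt hx0.le,
          Real.exp_log (Real.sqrt_pos.2 hx0)]
        ring
    _ ≤ Real.exp (-(Real.log x / 4)) := Real.exp_le_exp.2 (by linarith [log_four_le hx])

theorem log_le_two_mul_sqrt {x : ℝ} (hx : 0 < x) : Real.log x ≤ 2 * √x := by
  have h := Real.log_le_sub_one_of_pos (Real.sqrt_pos.2 hx)
  rw [Real.log_sqrt hx.le] at h
  linarith

theorem sqrt_le_two_mul_div_log {x : ℝ} (hx : 1 < x) : √x ≤ 2 * (x / Real.log x) := by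
  have hx0 : 0 < x := by linarith
  rw [mul_div_assoc', le_div_iff₀ (Real.log_pos hx)]
  calc √x * Real.log x ≤ √x * (2 * √x) := by gcongr; exact log_le_two_mul_sqrt hx0
    _ = 2 * x := by rw [mul_left_comm, Real.mul_self_sqrt hx0.le]

theorem eight_mul_cube_le_exp {r : ℝ} (hr : 8 ≤ r) : 8 * r ^ 3 ≤ Real.exp (4 * Real.log r) :=
  calc 8 * r ^ 3 ≤ r * r ^ 3 := by gcongr
    _ = r ^ 4 := (pow_succ' r 3).symm
    _ = Real.exp (4 * Real.log r) := by
      rw [mul_comm, Real.exp_mul, Real.exp_log (by linarith)]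
      norm_cast

/-- A number of batches that suffices for one layer when `γ = 1 / √(log ρ)`. The potential is at
most `8ρ³ ≤ exp (4 log ρ)` at first and every batch multiplies it by `4γ ≤ exp (-(log log ρ) / 4)`,
so that all but the last batch bring it below `1`. -/
noncomputable def batchCount (ρ : ℝ) : ℕ :=
  ⌊16 * (Real.log ρ / Real.log (Real.log ρ))⌋₊ + 2

theorem batchCount_pow_mul_lt {ρ : ℝ} (hρ : 0 ≤ ρ) (hlog : 256 ≤ Real.log ρ) :
    (4 * (1 / √(Real.log ρ))) ^ batchCount ρ * (8 * ρ ^ 3) < 4 * (1 / √(Real.log ρ)) := by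
  have hlog0 : 0 < Real.log ρ := by linarith
  have hloglog : 0 < Real.log (Real.log ρ) := Real.log_pos (by linarith)
  set q := 4 * (1 / √(Real.log ρ))
  set b := ⌊16 * (Real.log ρ / Real.log (Real.log ρ))⌋₊ + 1
  have hq : 0 < q := mul_pos four_pos (one_div_pos.2 (Real.sqrt_pos.2 hlog0))
  have hb : 16 * Real.log ρ < b * Real.log (Real.log ρ) := by
    rw [← div_lt_iff₀ hloglog, mul_div_assoc]
    exact_mod_cast Nat.lt_floor_add_one _
  have hlt : q ^ b * (8 * ρ ^ 3) < 1 :=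
    calc q ^ b * (8 * ρ ^ 3)
      _ ≤ Real.exp (-(Real.log (Real.log ρ) / 4)) ^ b * Real.exp (4 * Real.log ρ) := by
        gcongr
        · exact four_div_sqrt_le hlog
        · exact eight_mul_cube_le_exp (by linarith [Real.log_le_self hρ])
      _ = Real.exp (4 * Real.log ρ - b * Real.log (Real.log ρ) / 4) := by
        rw [← Real.exp_nat_mul, ← Real.exp_add]
        ring_nf
      _ < 1 := Real.exp_lt_one_iff.2 (by linarith)
  calc q ^ batchCount ρ * (8 * ρ ^ 3) = q * (q ^ b * (8 * ρ ^ 3)) := by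
        rw [← mul_assoc q, ← pow_succ']; rfl
    _ < q := mul_lt_of_lt_one_right hq hlt

theorem approximationFactor_le {ρ : ℝ} (hlog : 256 ≤ Real.log ρ) :
    1 / (1 / √(Real.log ρ)) + 3 * batchCount ρ ≤
      56 * (Real.log ρ / Real.log (Real.log ρ)) := by
  have hlog0 : 0 < Real.log ρ := by linarith
  have hloglog : 0 < Real.log (Real.log ρ) := Real.log_pos (by linarith)
  have hone : 1 ≤ Real.log ρ / Real.log (Real.log ρ) :=
    (one_le_div hloglog).2 (Real.log_le_self hlog0.le)
  have hbatch : (batchCount ρ : ℝ) ≤ 16 * (Real.log ρ / Real.log (Real.log ρ)) + 2 := by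
    rw [batchCount, Nat.cast_add, Nat.cast_ofNat]
    gcongr
    exact Nat.floor_le (by positivity)
  rw [one_div_one_div]
  linarith [sqrt_le_two_mul_div_log (by linarith : 1 < Real.log ρ)]

theorem two_thirds_pow_logCount_le {n : ℕ} (hn : 0 < n) {s c' : ℝ} (hs : 3 * s ≤ c') :
    ((2 : ℝ) / 3) ^ logCount c' n ≤ (n : ℝ) ^ (-s) := by
  have hlog : 0 ≤ Real.log n := Real.log_natCast_nonneg n
  have hcount : 3 * s * Real.log n ≤ logCount c' n := by
    rw [logCount, Nat.cast_max]
    exact (mul_le_mul_of_nonneg_right hs hlog).trans ((Nat.le_ceil _).trans (le_max_right _ _))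
  have hexp : (2 : ℝ) / 3 ≤ Real.exp (-(1 / 3)) := by
    linarith [Real.add_one_le_exp (-(1 / 3) : ℝ)]
  calc ((2 : ℝ) / 3) ^ logCount c' n ≤ Real.exp (-(1 / 3)) ^ logCount c' n := by gcongr
    _ = Real.exp (logCount c' n * -(1 / 3)) := by rw [← Real.exp_nat_mul]
    _ ≤ Real.exp (Real.log n * -s) := Real.exp_le_exp.2 (by linarith)
    _ = (n : ℝ) ^ (-s) := by rw [Real.rpow_def_of_pos (Nat.cast_pos.2 hn)]

theorem sq_add_four_mul_pow_four_le {n : ℕ} (hn : 2 ≤ n) : n ^ 2 + 4 * n ^ 4 ≤ n ^ 7 :=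
  calc n ^ 2 + 4 * n ^ 4 ≤ n ^ 4 + 4 * n ^ 4 := by gcongr <;> lia
    _ ≤ 2 ^ 3 * n ^ 4 := by lia
    _ ≤ n ^ 3 * n ^ 4 := by gcongr
    _ = n ^ 7 := by rw [← pow_add]

theorem le_treeSize {c : ℝ} (hc : 34 ≤ c) : 300 ≤ treeSize c := by
  have hceil : (300 : ℝ) ≤ treeSize c := by
    refine le_trans ?_ (Nat.le_ceil _)
    rw [eps]
    norm_num
    linarith
  exact_mod_cast hceil

variable {V : Type*} [Fintype V] {cfg : Config V}

theorem totalError_le (hV : 2 ≤ Fintype.card V) {d : ℝ} (hc' : 3 * (d + 7) ≤ cfg.c') :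
    totalError cfg ≤ ENNReal.ofReal (1 / (Fintype.card V : ℝ) ^ d) := by
  rw [totalError, estimateError]
  set n := Fintype.card V
  have hn : (0 : ℝ) < n := by positivity
  calc _ = ((n ^ 2 + 4 * n ^ 4 : ℕ) : ℝ≥0∞) * ENNReal.ofReal ((2 / 3) ^ logCount cfg.c' n) := by
        push_cast
        ring
    _ ≤ ((n ^ 7 : ℕ) : ℝ≥0∞) * ENNReal.ofReal ((n : ℝ) ^ (-(d + 7))) := by
        gcongr
        · exact sq_add_four_mul_pow_four_le hV
        · exact two_thirds_pow_logCount_le (by lia) hc'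
    _ = ENNReal.ofReal (1 / (n : ℝ) ^ d) := by
        rw [← ENNReal.ofReal_natCast, ← ENNReal.ofReal_mul (by positivity), Nat.cast_pow,
          ← Real.rpow_natCast, ← Real.rpow_add hn, one_div, ← Real.rpow_neg hn.le]
        congr 2
        push_cast
        ring

theorem ofReal_one_sub_le {d : ℝ} (hc' : 3 * (d + 7) ≤ cfg.c') :
    ENNReal.ofReal (1 - 1 / (Fintype.card V : ℝ) ^ d) ≤ 1 - totalError cfg := by
  rcases lt_or_ge (Fintype.card V) 2 with hV | hV
  · interval_cases hcard : Fintype.card V <;> simp [totalError, hcard, Real.rpow_nonneg]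
  · rw [ENNReal.ofReal_sub _ (by positivity), ENNReal.ofReal_one]
    exact tsub_le_tsub_left (totalError_le hV hc') 1

theorem le_outputProb_scheduleGeneralGraph [DecidableEq V] (ht : 300 ≤ treeSize cfg.c)
    {G : Digraph V} (hG : Acyclic G) (M : ℕ) [NeZero M] {ρ : ℕ} (hlog : 256 ≤ Real.log ρ) :
    1 - totalError cfg ≤
      outputProb (fun fuel => scheduleGeneralGraph cfg G M ρ (1 / √(Real.log ρ)) fuel)
        {σ | IsFeasible G ρ σ ∧ (makespan σ : ℝ) ≤
          56 * (Real.log ρ / Real.log (Real.log ρ)) * ((OPT G M ρ : ℝ) + ρ)} := by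
  have hρ : 0 < ρ := by
    rw [← Nat.cast_pos (α := ℝ)]
    linarith [Real.log_le_self (Nat.cast_nonneg (α := ℝ) ρ)]
  have hsqrt : 16 ≤ √(Real.log ρ) := Real.le_sqrt_of_sq_le (by norm_num; exact hlog)
  have hγ : 4 * (1 / √(Real.log ρ)) < 1 := by
    rw [mul_one_div, div_lt_one (by linarith)]
    linarith
  refine ((scheduleGeneralGraph_isFeasible ht hG (by positivity) hγ hρ
    (batchCount_pow_mul_lt (Nat.cast_nonneg ρ) hlog) le_rfl).mono
      fun σ ⟨hσ, hle⟩ => ⟨hσ, ?_⟩).le_outputProb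
  obtain ⟨σ', hσ', hopt⟩ : ∃ σ' : Schedule V M, IsFeasible G ρ σ' ∧ makespan σ' = OPT G M ρ :=
    Nat.sInf_mem (s := {T | ∃ σ : Schedule V M, IsFeasible G ρ σ ∧ makespan σ = T}) ⟨_, σ, hσ, rfl⟩
  rw [← hopt]
  exact (hle σ' hσ').trans (by gcongr; exact approximationFactor_le hlog)

end Parameters

end CommDelay

theorem mainTheorem2 :
    ∃ c₀ C : ℝ, ∃ ρ₀ : ℕ, ∀ c : ℝ, c₀ ≤ c → ∀ d : ℝ, 1 ≤ d → ∃ c'₀ : ℝ, ∀ c' : ℝ, c'₀ ≤ c' →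
      ∀ a : ℝ, 0 < a →
      ∀ (V : Type*) [Fintype V] [DecidableEq V] (G : Digraph V), CommDelay.Acyclic G →
      ∀ (hashV : CommDelay.TwoUniversalFamily V (Fintype.card V ^ 3))
        (hashE : CommDelay.TwoUniversalFamily (V × V) (Fintype.card (V × V) ^ 3))
        (M : ℕ) [NeZero M] (ρ : ℕ), ρ₀ ≤ ρ →
        ENNReal.ofReal (1 - 1 / (Fintype.card V : ℝ) ^ d) ≤
          CommDelay.outputProb
            (fun fuel => CommDelay.scheduleGeneralGraph ⟨c, c', a, hashV, hashE⟩ G M ρ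
              (1 / √(Real.log ρ)) fuel)
            {σ | CommDelay.IsFeasible G ρ σ ∧
              (CommDelay.makespan σ : ℝ) ≤
                C * (Real.log ρ / Real.log (Real.log ρ)) * ((CommDelay.OPT G M ρ : ℝ) + ρ)} := by
  refine ⟨34, 56, ⌈Real.exp 256⌉₊, fun c hc d _ => ⟨3 * (d + 7), fun c' hc' a _ V _ _ G hG hashV
    hashE M _ ρ hρ => ?_⟩⟩
  have hexp : Real.exp 256 ≤ ρ := Nat.ceil_le.1 hρ
  have hlog : 256 ≤ Real.log ρ := (Real.le_log_iff_exp_le (hexp.trans_lt' (Real.exp_pos _))).2 hexp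
  exact (CommDelay.ofReal_one_sub_le hc').trans
    (CommDelay.le_outputProb_scheduleGeneralGraph (CommDelay.le_treeSize hc) hG M hlog)
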